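/- For $k\in\mathbb{R}$ let $w_k(x)=(1+|x|)^k$ and $\|f\|_{L^p(w_k)}=\big(\int_{\mathbb{R}}|f(x)|^p\,w_k(x)^p\,dx\big)^{1/p}$. For $\gamma\in[0,1)$ let $\mathscr{E}_\gamma$ be the set of all nonnegative $G\in\bigcap_{s<3}L^1(w_s)$ with $$\int_{\mathbb{R}}G(x)\,dx=1,\qquad \int_{\mathbb{R}}x\,G(x)\,dx=0,$$ that solve $\tfrac14\,\partial_x(xG)=\mathcal{Q}_\gamma(G,G)$ in the weak sense, that is, $$-\frac14\int_{\mathbb{R}}x\,\varphi'(x)\,G(x)\,dx=\frac12\int_{\mathbb{R}^2}G(x)\,G(y)\Big(2\varphi\big(\tfrac{x+y}{2}\big)-\varphi(x)-\varphi(y)\Big)|x-y|^\gamma\,dx\,dy$$ for every $\varphi\in C^1(\mathbb{R})$ such that $\varphi$ and $\varphi'$ are bounded. Let $$H(x)=\frac{2}{\pi(1+x^2)^2},\qquad \lambda_0=\exp\Big(\frac12\int_{\mathbb{R}^2}H(x)H(y)|x-y|^2\log|x-y|\,dx\,dy\Big),\qquad G_0(x)=\lambda_0H(\lambda_0x).$$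 Then for every $\delta\in(0,\tfrac12)$ there exist $\gamma_\star\in(0,1)$ and $C>0$ such that $$\|G_\gamma\|_{L^2(w_k)}\le C$$ for all $\gamma\in[0,\gamma_\star)$, all $k\in\mathbb{R}$ with $k+\gamma\in(0,3-\delta)$, and all $G_\gamma\in\mathscr{E}_\gamma$, where for $\gamma=0$ only those elements of $\mathscr{E}_0$ are considered that have the same energy as $G_0$, i.e. $\int_{\mathbb{R}}x^2G_\gamma(x)\,dx=\int_{\mathbb{R}}x^2G_0(x)\,dx$. -/

import Mathlib

open MeasureTheory
open scoped ENNReal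

noncomputable section

namespace StickyParticles

/-- The weight `w_k(x) = (1 + |x|)^k`, for real `k`. -/
def weight (k : ℝ) (x : ℝ) : ℝ := (1 + |x|) ^ k

/-- The norm of the weighted space `L^p(ϖ)`, i.e. `(∫ |f(x)|^p ϖ(x)^p dx)^{1/p}`, with values in
`[0, ∞]`. -/
def weightedNorm (p : ℝ≥0∞) (ϖ : ℝ → ℝ) (f : ℝ → ℝ) : ℝ≥0∞ :=
  eLpNorm (fun x => f x * ϖ x) p volume

/-- Membership in the weighted space `L^p(ϖ)`. -/
def MemWeighted (p : ℝ≥0∞) (ϖ : ℝ → ℝ) (f : ℝ → ℝ) : Prop :=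
  MemLp (fun x => f x * ϖ x) p volume

/-- The moment `M_s(f) = ∫ f(x) |x|^s dx`. -/
def moment (s : ℝ) (f : ℝ → ℝ) : ℝ := ∫ x : ℝ, f x * |x| ^ s

/-- `Δφ(x, y) = 2 φ((x + y) / 2) - φ(x) - φ(y)`. -/
def collisionDiff (φ : ℝ → ℝ) (x y : ℝ) : ℝ := 2 * φ ((x + y) / 2) - φ x - φ y

/-- The collision operator in weak form: the pairing of `Q_γ(f, g)` with the test function `φ`,
`(1/2) ∫∫ f(x) g(y) Δφ(x, y) |x - y|^γ dx dy`. -/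
def collisionPairing (γ : ℝ) (f g φ : ℝ → ℝ) : ℝ :=
  (1 / 2) * ∫ p : ℝ × ℝ, f p.1 * g p.2 * collisionDiff φ p.1 p.2 * |p.1 - p.2| ^ γ

/-- Test functions of class `C_b^1`: continuously differentiable, bounded, with bounded
derivative. -/
def IsTestFunction (φ : ℝ → ℝ) : Prop :=
  ContDiff ℝ 1 φ ∧ ∃ M : ℝ, ∀ x, |φ x| ≤ M ∧ |deriv φ x| ≤ M

/-- `G` is a weak solution of the steady self-similar equation
`(1/4) ∂ₓ(x G) = Q_γ(G, G)`. -/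
def IsSteadySolution (γ : ℝ) (G : ℝ → ℝ) : Prop :=
  ∀ φ : ℝ → ℝ, IsTestFunction φ →
    -(1 / 4) * ∫ x : ℝ, x * deriv φ x * G x = collisionPairing γ G G φ

/-- `G` is a self-similar profile: it is nonnegative, belongs to `L^1(w_s)` for every `s < 3`, has
unit mass and zero momentum, and solves the steady equation. -/
structure IsProfile (γ : ℝ) (G : ℝ → ℝ) : Prop where
  memWeighted : ∀ s : ℝ, s < 3 → MemWeighted 1 (weight s) G
  nonneg : ∀ᵐ x : ℝ, 0 ≤ G x
  mass : ∫ x : ℝ, G x = 1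
  momentum : ∫ x : ℝ, G x * x = 0
  steady : IsSteadySolution γ G

/-- The set `𝓔_γ` of self-similar profiles. -/
def profiles (γ : ℝ) : Set (ℝ → ℝ) := {G | IsProfile γ G}

/-- The Maxwell profile of unit mass and unit energy, `H(x) = 2 / (π (1 + x²)²)`. -/
def maxwellProfile (x : ℝ) : ℝ := 2 / (Real.pi * (1 + x ^ 2) ^ 2)

/-- `I₀(H, H) = ∫∫ H(x) H(y) |x - y|² log |x - y| dx dy`. -/
def logEnergy : ℝ :=
  ∫ p : ℝ × ℝ, maxwellProfile p.1 * maxwellProfile p.2 * |p.1 - p.2| ^ 2 * Real.log |p.1 - p.2|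

/-- `λ₀ = exp(I₀(H, H) / 2)`. -/
def limitScale : ℝ := Real.exp (logEnergy / 2)

/-- The Maxwell profile `G₀(x) = λ₀ H(λ₀ x)` selected in the limit `γ → 0⁺`. -/
def limitProfile (x : ℝ) : ℝ := limitScale * maxwellProfile (limitScale * x)

end StickyParticles

end

namespace StickyParticles

open Filter Topology Set

/-! Write m = G dx. It suffices to have pointwise bounds uniform in γ < 1/2 and in the profile, G ≤
A|x|^(-1/4) for |x| < 1 and G ≤ W|x|^(γ-7/2) for |x| ≥ 1 (`exists_pointwise_bounds`): multiplied by
the weight, both are dominated by one square integrable function.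

Moments (`SteadyMeasure.moment_bounds`). Testing with x² gives ∬|x-y|^(2+γ) = ∬|x-y|² = 2M₂. For γ >
0, Bernoulli's inequality turns this into M₂ ≤ 1/2 and 2M₂ ≤ ∬|x-y|^(5/2), with the factor γ
cancelling, hence uniformly as γ → 0. Testing with |x|^(5/2) bounds M_(5/2) by a multiple of
M₂^(5/4) + M₂^(3/2), and the second inequality then keeps M₂ away from zero. At γ = 0 the x²
identity is empty, which is why the energy is prescribed there.

Density. A trapezoid with slopes on a < |x| < b as test function expresses the first absolute moment
of that annulus through collisions. Dropping the loss gives a·m(annulus) ≤ 4(b-a)q(b), where q(r) is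
the mass the gain produces in [-r, r]; bounding the gain by 2 leaves only collisions with a partner
beyond a. Letting b decrease to a = |x|, the outer bound follows from the 5/2 moment, and the inner
one reduces to q(r) ≤ A r^(3/4).

Decay of q (`SteadyMeasure.exists_gainMass_le_rpow`). The moment bounds leave a fixed amount of mass
away from the origin, so particles in a small ball are lost at a definite rate and the gain must
compensate (`loss_le_gain`). Pigeonholing over geometric scales shows that m(ball), and then q, is
uniformly small at some radius. Below that radius q is bounded by a quadratic near term, an
intermediate term with a small prefactor and a far term linear in r; this closes an induction over
dyadic radii. -/

/-- The measure-theoretic form of a self-similar profile: an absolutely continuous centred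
probability measure with finite moments of order less than three which solves the steady equation
against all bounded Lipschitz test functions. -/
structure SteadyMeasure (γ : ℝ) (m : Measure ℝ) : Prop where
  prob : IsProbabilityMeasure m
  ac : m ≪ volume
  integrable_rpow : ∀ s : ℝ, 0 ≤ s → s < 3 → Integrable (fun x : ℝ => |x| ^ s) m
  mean : ∫ x : ℝ, x ∂m = 0
  weak : ∀ φ ψ : ℝ → ℝ, (∃ M : ℝ, ∀ x, |φ x| ≤ M) → (∃ L : ℝ, ∀ x y, |φ x - φ y| ≤ L * |x - y|) →
    (∀ᵐ x : ℝ, HasDerivAt φ (ψ x) x) →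
    -(1 / 4) * ∫ x : ℝ, x * ψ x ∂m =
      (1 / 2) * ∫ p : ℝ × ℝ, collisionDiff φ p.1 p.2 * |p.1 - p.2| ^ γ ∂(m.prod m)

/-! ### From C¹ to bounded Lipschitz test functions -/

theorem tendsto_forward_difference {f : ℝ → ℝ} {f' x : ℝ} (h : HasDerivAt f f' x) :
    Tendsto (fun n : ℕ => ((n : ℝ) + 1) * (f (x + 1 / ((n : ℝ) + 1)) - f x)) atTop (𝓝 f') := by
  have h1 := h.tendsto_slope
  have h2 : Tendsto (fun n : ℕ => x + 1 / ((n : ℝ) + 1)) atTop (𝓝[≠] x) := by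
    rw [tendsto_nhdsWithin_iff]
    refine ⟨?_, Eventually.of_forall fun n => ?_⟩
    · simpa using tendsto_one_div_add_atTop_nhds_zero_nat.const_add x
    · have : (0 : ℝ) < 1 / ((n : ℝ) + 1) := by positivity
      simp only [mem_compl_iff, mem_singleton_iff]
      linarith
  refine (h1.comp h2).congr fun n => ?_
  simp [slope_def_field]
  ring

theorem abs_rpow_le_one_add {t γ : ℝ} (ht : 0 ≤ t) (h0 : 0 ≤ γ) (h1 : γ ≤ 1) : t ^ γ ≤ 1 + t := by
  rcases le_total t 1 with h | h
  · have := Real.rpow_le_one ht h h0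
    linarith
  · have := Real.rpow_le_rpow_of_exponent_le h h1
    rw [Real.rpow_one] at this
    linarith

theorem abs_sub_rpow_le {γ : ℝ} (h0 : 0 ≤ γ) (h1 : γ ≤ 1) (x y : ℝ) :
    |x - y| ^ γ ≤ 1 + |x| + |y| := by
  have := abs_rpow_le_one_add (abs_nonneg (x - y)) h0 h1
  have := abs_sub x y
  linarith

theorem measurable_abs_sub_rpow (γ : ℝ) :
    Measurable (fun p : ℝ × ℝ => |p.1 - p.2| ^ γ) := by
  have h : Measurable fun p : ℝ × ℝ => |p.1 - p.2| :=
    ((continuous_fst.sub continuous_snd).abs).measurable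
  exact h.pow_const γ

theorem measurable_collisionDiff {φ : ℝ → ℝ} (h : Measurable φ) :
    Measurable (fun p : ℝ × ℝ => collisionDiff φ p.1 p.2) := by
  unfold collisionDiff
  have h3 : Measurable fun p : ℝ × ℝ => (p.1 + p.2) / 2 := by fun_prop
  have h1 : Measurable fun p : ℝ × ℝ => φ p.1 := h.comp measurable_fst
  have h2 : Measurable fun p : ℝ × ℝ => φ p.2 := h.comp measurable_snd
  exact (((h.comp h3).const_mul 2).sub h1).sub h2

section extension

variable {m : Measure ℝ} [IsProbabilityMeasure m]

theorem integrable_prod_add {f g : ℝ → ℝ} (hf : Integrable f m) (hg : Integrable g m) :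
    Integrable (fun p : ℝ × ℝ => f p.1 + g p.2) (m.prod m) :=
  (hf.comp_fst m).add (hg.comp_snd m)

/-- Averaging a Lipschitz φ over short intervals gives admissible C¹ functions with the same bounds
on value and slope; dominated convergence passes to the limit on both sides. This makes truncated
powers and trapezoids available. -/
theorem weak_extension {γ : ℝ} (h0 : 0 ≤ γ) (h1 : γ ≤ 1) (hm : Integrable (fun x : ℝ => |x|) m)
    (hac : m ≪ volume)
    (hweak : ∀ φ : ℝ → ℝ, IsTestFunction φ → -(1 / 4) * ∫ x : ℝ, x * deriv φ x ∂m =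
      (1 / 2) * ∫ p : ℝ × ℝ, collisionDiff φ p.1 p.2 * |p.1 - p.2| ^ γ ∂(m.prod m))
    {φ ψ : ℝ → ℝ} {M L : ℝ} (hM : ∀ x, |φ x| ≤ M) (hL : ∀ x y, |φ x - φ y| ≤ L * |x - y|)
    (hψ : ∀ᵐ x : ℝ, HasDerivAt φ (ψ x) x) :
    -(1 / 4) * ∫ x : ℝ, x * ψ x ∂m =
      (1 / 2) * ∫ p : ℝ × ℝ, collisionDiff φ p.1 p.2 * |p.1 - p.2| ^ γ ∂(m.prod m) := by
  have hL0 : 0 ≤ L := by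
    have := (abs_nonneg _).trans (hL 1 0)
    simpa using this
  have hM0 : 0 ≤ M := (abs_nonneg _).trans (hM 0)
  have hc : Continuous φ := by
    refine (LipschitzWith.of_dist_le_mul (K := ⟨L, hL0⟩) fun x y => ?_).continuous
    exact hL x y
  set F : ℝ → ℝ := fun x => ∫ t in (0 : ℝ)..x, φ t with hF
  have hFd : ∀ x, HasDerivAt F (φ x) x := fun x => hc.integral_hasStrictDerivAt 0 x |>.hasDerivAt
  have hFc : Continuous F := continuous_iff_continuousAt.2 fun x => (hFd x).continuousAt
  have hFL : ∀ x y, |F x - F y| ≤ M * |x - y| := by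
    intro x y
    have : F x - F y = ∫ t in y..x, φ t := by
      simp only [hF]
      rw [intervalIntegral.integral_interval_sub_left] <;> exact hc.intervalIntegrable _ _
    rw [this]
    have := intervalIntegral.norm_integral_le_of_norm_le_const (a := y) (b := x) (f := φ) (C := M)
      fun t _ => hM t
    exact this
  -- Mean of φ over [x, x + 1/(n+1)]; its derivative Ψ n is a forward difference quotient of φ.
  set Φ : ℕ → ℝ → ℝ := fun n x => ((n : ℝ) + 1) * (F (x + 1 / ((n : ℝ) + 1)) - F x) with hΦ
  set Ψ : ℕ → ℝ → ℝ := fun n x => ((n : ℝ) + 1) * (φ (x + 1 / ((n : ℝ) + 1)) - φ x) with hΨ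
  have hΦd : ∀ n x, HasDerivAt (Φ n) (Ψ n x) x := by
    intro n x
    exact (((hFd _).comp_add_const x _).sub (hFd x)).const_mul _
  have hstep : ∀ n : ℕ, ∀ x : ℝ, ((n : ℝ) + 1) * |x + 1 / ((n : ℝ) + 1) - x| = 1 := by
    intro n x
    have : (0 : ℝ) < (n : ℝ) + 1 := by positivity
    rw [add_sub_cancel_left, abs_of_pos (by positivity)]
    field_simp
  have hΦM : ∀ n x, |Φ n x| ≤ M := by
    intro n x
    have h3 : (0 : ℝ) < (n : ℝ) + 1 := by positivity
    simp only [hΦ]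
    rw [abs_mul, abs_of_pos h3]
    calc _ ≤ ((n : ℝ) + 1) * (M * |x + 1 / ((n : ℝ) + 1) - x|) := by gcongr; exact hFL _ _
      _ = M * (((n : ℝ) + 1) * |x + 1 / ((n : ℝ) + 1) - x|) := by ring
      _ = M := by rw [hstep]; ring
  have hΨL : ∀ n x, |Ψ n x| ≤ L := by
    intro n x
    have h3 : (0 : ℝ) < (n : ℝ) + 1 := by positivity
    simp only [hΨ]
    rw [abs_mul, abs_of_pos h3]
    calc _ ≤ ((n : ℝ) + 1) * (L * |x + 1 / ((n : ℝ) + 1) - x|) := by gcongr; exact hL _ _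
      _ = L * (((n : ℝ) + 1) * |x + 1 / ((n : ℝ) + 1) - x|) := by ring
      _ = L := by rw [hstep]; ring
  have hΨc : ∀ n, Continuous (Ψ n) := by
    intro n
    simp only [hΨ]
    fun_prop
  have hΦc : ∀ n, Continuous (Φ n) := by
    intro n
    simp only [hΦ]
    fun_prop
  have hderiv : ∀ n, deriv (Φ n) = Ψ n := fun n => funext fun x => (hΦd n x).deriv
  have htest : ∀ n, IsTestFunction (Φ n) := by
    intro n
    refine ⟨contDiff_one_iff_deriv.2 ⟨fun x => (hΦd n x).differentiableAt, ?_⟩, max M L,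
      fun x => ⟨(hΦM n x).trans (le_max_left _ _), ?_⟩⟩
    · rw [hderiv]; exact hΨc n
    · rw [hderiv]; exact (hΨL n x).trans (le_max_right _ _)
  have hlim1 : Tendsto (fun n => ∫ x : ℝ, x * Ψ n x ∂m) atTop (𝓝 (∫ x : ℝ, x * ψ x ∂m)) := by
    refine tendsto_integral_of_dominated_convergence (fun x => |x| * L)
      (fun n => (continuous_id.mul (hΨc n)).aestronglyMeasurable) (hm.mul_const L)
      (fun n => Eventually.of_forall fun x => ?_) ?_
    · rw [Real.norm_eq_abs, abs_mul]
      gcongr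
      exact hΨL n x
    -- Differentiability holds only Lebesgue-a.e.; absolute continuity of m transfers it.
    · filter_upwards [hac.ae_le hψ] with x hx
      exact (tendsto_forward_difference hx).const_mul x
  have hlim2 : Tendsto (fun n => ∫ p : ℝ × ℝ, collisionDiff (Φ n) p.1 p.2 * |p.1 - p.2| ^ γ
      ∂(m.prod m)) atTop
      (𝓝 (∫ p : ℝ × ℝ, collisionDiff φ p.1 p.2 * |p.1 - p.2| ^ γ ∂(m.prod m))) := by
    refine tendsto_integral_of_dominated_convergence (fun p => 4 * M * ((1 + |p.1|) + |p.2|))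
      (fun n => ((measurable_collisionDiff (hΦc n).measurable).mul
        (measurable_abs_sub_rpow γ)).aestronglyMeasurable)
      ((integrable_prod_add (((integrable_const 1).add hm)) hm).const_mul _)
      (fun n => Eventually.of_forall fun p => ?_) (Eventually.of_forall fun p => ?_)
    · rw [Real.norm_eq_abs, abs_mul, abs_of_nonneg (a := |p.1 - p.2| ^ γ) (by positivity)]
      refine mul_le_mul ?_ (abs_sub_rpow_le h0 h1 _ _) (by positivity) (by positivity)
      unfold collisionDiff
      have a1 := abs_le.1 (hΦM n ((p.1 + p.2) / 2))
      have a2 := abs_le.1 (hΦM n p.1)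
      have a3 := abs_le.1 (hΦM n p.2)
      rw [abs_le]
      constructor <;> linarith
    · refine Tendsto.mul_const _ ?_
      have t := fun x => tendsto_forward_difference (hFd x)
      exact (((t _).const_mul 2).sub (t _)).sub (t _)
  refine tendsto_nhds_unique (hlim1.const_mul (-(1 / 4))) ?_
  refine (hlim2.const_mul (1 / 2)).congr fun n => ?_
  rw [← hweak _ (htest n), hderiv]

end extension

theorem IsProfile.steadyMeasure {γ : ℝ} {G : ℝ → ℝ} (h0 : 0 ≤ γ) (h1 : γ ≤ 1)
    (hG : IsProfile γ G) :
    SteadyMeasure γ (volume.withDensity fun x => ENNReal.ofReal (G x)) := by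
  have hGi : Integrable G := by
    have := hG.memWeighted 0 (by norm_num)
    unfold MemWeighted weight at this
    simpa [memLp_one_iff_integrable] using this
  set d : ℝ → ℝ≥0∞ := fun x => ENNReal.ofReal (G x) with hd
  set m := volume.withDensity d with hm
  have hdm : AEMeasurable d := hGi.aestronglyMeasurable.aemeasurable.ennreal_ofReal
  have hdt : ∀ᵐ x : ℝ, d x < ∞ := Eventually.of_forall fun x => ENNReal.ofReal_lt_top
  have hint : ∀ f : ℝ → ℝ, ∫ x, f x ∂m = ∫ x, f x * G x := by
    intro f
    rw [hm, integral_withDensity_eq_integral_toReal_smul₀ hdm hdt]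
    refine integral_congr_ae ?_
    filter_upwards [hG.nonneg] with x hx
    simp [hd, ENNReal.toReal_ofReal hx, mul_comm]
  have hprob : IsProbabilityMeasure m := by
    constructor
    rw [hm, withDensity_apply _ MeasurableSet.univ, Measure.restrict_univ,
      ← ofReal_integral_eq_lintegral_ofReal hGi hG.nonneg, hG.mass]
    simp
  have hac : m ≪ volume := withDensity_absolutelyContinuous _ _
  have hrp : ∀ s : ℝ, 0 ≤ s → s < 3 → Integrable (fun x : ℝ => |x| ^ s) m := by
    intro s hs0 hs3
    rw [hm, integrable_withDensity_iff_integrable_smul₀' hdm hdt]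
    have := hG.memWeighted s hs3
    unfold MemWeighted weight at this
    rw [memLp_one_iff_integrable] at this
    refine this.mono ((hdm.ennreal_toReal.mul
      ((measurable_norm.pow_const s).aemeasurable)).aestronglyMeasurable) ?_
    filter_upwards [hG.nonneg] with x hx
    simp only [hd, ENNReal.toReal_ofReal hx, smul_eq_mul, norm_mul, Real.norm_eq_abs]
    refine mul_le_mul_of_nonneg_left ?_ (abs_nonneg _)
    have e : 0 ≤ |x| := abs_nonneg x
    rw [abs_of_nonneg (Real.rpow_nonneg e s), abs_of_nonneg (Real.rpow_nonneg (by linarith) s)]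
    exact Real.rpow_le_rpow e (by linarith) hs0
  have habs : Integrable (fun x : ℝ => |x|) m := by
    simpa using hrp 1 zero_le_one (by norm_num)
  refine ⟨hprob, hac, hrp, ?_, ?_⟩
  · rw [hint, ← hG.momentum]
    simp [mul_comm]
  · rintro φ ψ ⟨M, hM⟩ ⟨L, hL⟩ hψ
    refine weak_extension h0 h1 habs hac (fun f hf => ?_) hM hL hψ
    rw [hint, hG.steady f hf]
    unfold collisionPairing
    congr 1
    rw [hm, prod_withDensity₀ hdm hdm, integral_withDensity_eq_integral_toReal_smul₀, 
      Measure.volume_eq_prod]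
    · refine integral_congr_ae ?_
      filter_upwards [Measure.quasiMeasurePreserving_fst.ae hG.nonneg,
        Measure.quasiMeasurePreserving_snd.ae hG.nonneg] with p hp1 hp2
      simp only [hd, ENNReal.toReal_mul, ENNReal.toReal_ofReal hp1, ENNReal.toReal_ofReal hp2,
        smul_eq_mul]
      ring
    · exact (hdm.comp_quasiMeasurePreserving Measure.quasiMeasurePreserving_fst).mul
        (hdm.comp_quasiMeasurePreserving Measure.quasiMeasurePreserving_snd)
    · exact Eventually.of_forall fun p => ENNReal.mul_lt_top ENNReal.ofReal_lt_top
        ENNReal.ofReal_lt_top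

/-! ### Moment identities from truncated powers -/

theorem rpow_cut_lipschitz {s N : ℝ} (hs : 1 ≤ s) (hN : 0 ≤ N) (x y : ℝ) :
    |(min |x| N) ^ s - (min |y| N) ^ s| ≤ s * N ^ (s - 1) * |x - y| := by
  have h1 : |(min |x| N) ^ s - (min |y| N) ^ s| ≤
      s * N ^ (s - 1) * |min |x| N - min |y| N| := by
    have := Convex.norm_image_sub_le_of_norm_hasDerivWithin_le (f := fun t : ℝ => t ^ s)
      (f' := fun t => s * t ^ (s - 1)) (s := Icc 0 N) (C := s * N ^ (s - 1))
      (x := min |y| N) (y := min |x| N)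
      (fun t _ => (Real.hasDerivAt_rpow_const (Or.inr hs)).hasDerivWithinAt)
      (fun t ht => ?_) (convex_Icc 0 N)
      ⟨le_min (abs_nonneg _) hN, min_le_right _ _⟩ ⟨le_min (abs_nonneg _) hN, min_le_right _ _⟩
    · exact this
    · rw [Real.norm_eq_abs, abs_of_nonneg (mul_nonneg (by linarith) (Real.rpow_nonneg ht.1 _))]
      exact mul_le_mul_of_nonneg_left (Real.rpow_le_rpow ht.1 ht.2 (by linarith)) (by linarith)
  refine h1.trans (mul_le_mul_of_nonneg_left ?_ (mul_nonneg (by linarith)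
    (Real.rpow_nonneg hN _)))
  calc _ ≤ |(|x| - |y|)| := by
        simpa using abs_min_sub_min_le_max |x| N |y| N
    _ ≤ |x - y| := abs_abs_sub_abs_le _ _

theorem ae_ne_volume (a : ℝ) : ∀ᵐ x : ℝ, x ≠ a := by
  simp [ae_iff, measure_singleton]

theorem rpow_cut_hasDerivAt {s N : ℝ} (hN : 0 < N) :
    ∀ᵐ x : ℝ, HasDerivAt (fun x => (min |x| N) ^ s)
      (if |x| < N then s * |x| ^ s / x else 0) x := by
  filter_upwards [ae_ne_volume 0, ae_ne_volume N, ae_ne_volume (-N)] with x h0 h1 h2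
  rcases lt_trichotomy |x| N with h | h | h
  · rw [if_pos h]
    have hd := (hasDerivAt_abs h0).rpow_const (p := s) (Or.inl (abs_ne_zero.2 h0))
    have hd' : HasDerivAt (fun x : ℝ => |x| ^ s) (s * |x| ^ s / x) x := by
      convert hd using 1
      rw [Real.rpow_sub_one (abs_ne_zero.2 h0)]
      rcases lt_or_gt_of_ne h0 with h3 | h3
      · simp only [h3, sign_neg, abs_of_neg h3]
        simp
        field_simp
      · simp only [h3, sign_pos, abs_of_pos h3]
        simp
        field_simp
    refine hd'.congr_of_eventuallyEq ?_
    filter_upwards [(continuous_abs.tendsto x).eventually (gt_mem_nhds h)] with y hy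
    rw [min_eq_left (le_of_lt hy)]
  · rcases (abs_eq hN.le).1 h with h3 | h3
    · exact absurd h3 h1
    · exact absurd h3 h2
  · rw [if_neg (not_lt.2 h.le)]
    refine (hasDerivAt_const x (N ^ s)).congr_of_eventuallyEq ?_
    filter_upwards [(continuous_abs.tendsto x).eventually (lt_mem_nhds h)] with y hy
    rw [min_eq_right (le_of_lt hy)]

theorem abs_sub_rpow_le_add {γ : ℝ} (h0 : 0 ≤ γ) (h1 : γ ≤ 1) (x y : ℝ) :
    |x - y| ^ γ ≤ |x| ^ γ + |y| ^ γ :=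
  (Real.rpow_le_rpow (abs_nonneg _) (abs_sub x y) h0).trans
    (Real.rpow_add_le_add_rpow (abs_nonneg _) (abs_nonneg _) h0 h1)

theorem abs_mid_le_max (x y : ℝ) : |(x + y) / 2| ≤ max |x| |y| := by
  rw [abs_div, abs_of_pos (by norm_num : (0 : ℝ) < 2)]
  have := abs_add_le x y
  have := le_max_left |x| |y|
  have := le_max_right |x| |y|
  linarith

theorem abs_mid_rpow_le {s : ℝ} (hs : 0 ≤ s) (x y : ℝ) :
    |(x + y) / 2| ^ s ≤ |x| ^ s + |y| ^ s := by
  have h1 : 0 ≤ |x| ^ s := by positivity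
  have h2 : 0 ≤ |y| ^ s := by positivity
  refine (Real.rpow_le_rpow (abs_nonneg _) (abs_mid_le_max x y) hs).trans ?_
  rcases max_choice |x| |y| with h | h <;> rw [h] <;> linarith

namespace SteadyMeasure

variable {γ : ℝ} {m : Measure ℝ}

theorem integrable_prod_rpow (h : SteadyMeasure γ m) {a b : ℝ} (ha : 0 ≤ a) (hb : 0 ≤ b)
    (ha3 : a < 3) (hb3 : b < 3) :
    Integrable (fun p : ℝ × ℝ => |p.1| ^ a * |p.2| ^ b) (m.prod m) := by
  have := h.prob
  exact (h.integrable_rpow a ha ha3).mul_prod (h.integrable_rpow b hb hb3)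

theorem integrable_moment_kernel (h : SteadyMeasure γ m) {a b : ℝ} (ha : 0 ≤ a) (hb : 0 ≤ b)
    (hab : a + b < 3) :
    Integrable (fun p : ℝ × ℝ => (|p.1| ^ a + |p.2| ^ a) * (|p.1| ^ b + |p.2| ^ b))
      (m.prod m) := by
  have i1 := h.integrable_prod_rpow (a := a + b) (b := 0) (by linarith) le_rfl hab (by norm_num)
  have i2 := h.integrable_prod_rpow (a := 0) (b := a + b) le_rfl (by linarith) (by norm_num) hab
  have i3 := h.integrable_prod_rpow ha hb (by linarith) (by linarith)
  have i4 := h.integrable_prod_rpow hb ha (by linarith) (by linarith)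
  refine (((i1.add i2).add i3).add i4).congr (Eventually.of_forall fun p => ?_)
  simp only [Pi.add_apply, Real.rpow_zero, mul_one, one_mul,
    Real.rpow_add_of_nonneg (abs_nonneg p.1) ha hb, Real.rpow_add_of_nonneg (abs_nonneg p.2) ha hb]
  ring

/-- The truncations min(|x|, n+1)^s are bounded, and Lipschitz because s ≥ 1. The condition s + γ <
3 makes the collision integrand dominated by products of finite moments. -/
theorem moment_identity (h : SteadyMeasure γ m) (h0 : 0 ≤ γ) (h1 : γ ≤ 1) {s : ℝ} (hs : 1 ≤ s)
    (hsγ : s + γ < 3) :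
    -(1 / 4) * (s * ∫ x : ℝ, |x| ^ s ∂m) =
      (1 / 2) * ∫ p : ℝ × ℝ, collisionDiff (fun t => |t| ^ s) p.1 p.2 * |p.1 - p.2| ^ γ
        ∂(m.prod m) := by
  have hprob := h.prob
  have hs0 : 0 ≤ s := by linarith
  set φ : ℕ → ℝ → ℝ := fun n x => (min |x| ((n : ℝ) + 1)) ^ s with hφ
  set ψ : ℕ → ℝ → ℝ := fun n x => if |x| < (n : ℝ) + 1 then s * |x| ^ s / x else 0 with hψ
  have hn : ∀ n : ℕ, (0 : ℝ) < (n : ℝ) + 1 := fun n => by positivity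
  have hφ0 : ∀ n x, 0 ≤ φ n x := fun n x =>
    Real.rpow_nonneg (le_min (abs_nonneg _) (hn n).le) _
  have hφle : ∀ n x, φ n x ≤ |x| ^ s := fun n x =>
    Real.rpow_le_rpow (le_min (abs_nonneg _) (hn n).le) (min_le_left _ _) hs0
  have hweak : ∀ n, -(1 / 4) * ∫ x : ℝ, x * ψ n x ∂m = (1 / 2) * ∫ p : ℝ × ℝ,
      collisionDiff (φ n) p.1 p.2 * |p.1 - p.2| ^ γ ∂(m.prod m) := by
    intro n
    refine h.weak (φ n) (ψ n) ⟨((n : ℝ) + 1) ^ s, fun x => ?_⟩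
      ⟨s * ((n : ℝ) + 1) ^ (s - 1), rpow_cut_lipschitz hs (hn n).le⟩ (rpow_cut_hasDerivAt (hn n))
    rw [abs_of_nonneg (hφ0 n x)]
    exact Real.rpow_le_rpow (le_min (abs_nonneg _) (hn n).le) (min_le_right _ _) hs0
  have hxψ : ∀ n x, x * ψ n x = if |x| < (n : ℝ) + 1 then s * |x| ^ s else 0 := by
    intro n x
    simp only [hψ]
    split_ifs
    · by_cases hx : x = 0
      · simp [hx, Real.zero_rpow (by linarith : s ≠ 0)]
      · field_simp
    · simp
  have hev : ∀ x : ℝ, ∀ᶠ n : ℕ in atTop, |x| < (n : ℝ) + 1 := by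
    intro x
    obtain ⟨k, hk⟩ := exists_nat_gt |x|
    filter_upwards [eventually_ge_atTop k] with n hn
    have : (k : ℝ) ≤ n := by exact_mod_cast hn
    linarith
  have hlim1 : Tendsto (fun n => ∫ x : ℝ, x * ψ n x ∂m) atTop
      (𝓝 (∫ x : ℝ, s * |x| ^ s ∂m)) := by
    refine tendsto_integral_of_dominated_convergence (fun x => s * |x| ^ s) (fun n => ?_)
      ((h.integrable_rpow s hs0 (by linarith)).const_mul s)
      (fun n => Eventually.of_forall fun x => ?_) (Eventually.of_forall fun x => ?_)
    · simp only [hxψ]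
      exact (Measurable.ite (measurableSet_lt measurable_norm measurable_const)
        ((measurable_norm.pow_const s).const_mul s) measurable_const).aestronglyMeasurable
    · have : 0 ≤ s * |x| ^ s := by positivity
      rw [hxψ]
      split_ifs
      · rw [Real.norm_eq_abs, abs_of_nonneg this]
      · simpa using this
    · refine tendsto_const_nhds.congr' ?_
      filter_upwards [hev x] with n hn
      rw [hxψ, if_pos hn]
  have hφlim : ∀ x, Tendsto (fun n => φ n x) atTop (𝓝 (|x| ^ s)) := by
    intro x
    refine tendsto_const_nhds.congr' ?_
    filter_upwards [hev x] with n hn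
    simp only [hφ]
    rw [min_eq_left hn.le]
  have hφm : ∀ n, Measurable (φ n) := fun n =>
    (measurable_norm.min measurable_const).pow_const s
  have hlim2 : Tendsto (fun n => ∫ p : ℝ × ℝ, collisionDiff (φ n) p.1 p.2 * |p.1 - p.2| ^ γ
      ∂(m.prod m)) atTop
      (𝓝 (∫ p : ℝ × ℝ, collisionDiff (fun t => |t| ^ s) p.1 p.2 * |p.1 - p.2| ^ γ
        ∂(m.prod m))) := by
    refine tendsto_integral_of_dominated_convergence
      (fun p => 3 * ((|p.1| ^ s + |p.2| ^ s) * (|p.1| ^ γ + |p.2| ^ γ)))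
      (fun n => ((measurable_collisionDiff (hφm n)).mul
        (measurable_abs_sub_rpow γ)).aestronglyMeasurable)
      ((h.integrable_moment_kernel hs0 h0 hsγ).const_mul 3)
      (fun n => Eventually.of_forall fun p => ?_) (Eventually.of_forall fun p => ?_)
    · rw [Real.norm_eq_abs, abs_mul, abs_of_nonneg (a := |p.1 - p.2| ^ γ) (by positivity),
        ← mul_assoc]
      refine mul_le_mul ?_ (abs_sub_rpow_le_add h0 h1 _ _) (by positivity) (by positivity)
      unfold collisionDiff
      have a1 := (hφle n ((p.1 + p.2) / 2)).trans (abs_mid_rpow_le hs0 _ _)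
      have a2 := hφle n p.1
      have a3 := hφle n p.2
      have b1 := hφ0 n ((p.1 + p.2) / 2)
      have b2 := hφ0 n p.1
      have b3 := hφ0 n p.2
      rw [abs_le]
      constructor <;> linarith
    · refine Tendsto.mul_const _ ?_
      exact (((hφlim _).const_mul 2).sub (hφlim _)).sub (hφlim _)
  rw [integral_const_mul] at hlim1
  refine tendsto_nhds_unique (hlim1.const_mul (-(1 / 4))) ?_
  refine (hlim2.const_mul (1 / 2)).congr fun n => ?_
  rw [← hweak n]

end SteadyMeasure

/-! ### Polynomial inequalities for half-integer powers -/

theorem abs_rpow_half (x : ℝ) (k : ℕ) : |x| ^ ((k : ℝ) / 2) = √|x| ^ k := by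
  rw [Real.sqrt_eq_rpow, ← Real.rpow_natCast, ← Real.rpow_mul (abs_nonneg _)]
  congr 1
  ring

theorem sqrt_abs_pow_four (x : ℝ) : √|x| ^ 4 = x ^ 2 := by
  rw [show √|x| ^ 4 = (√|x| ^ 2) ^ 2 by ring, Real.sq_sqrt (abs_nonneg _), sq_abs]

/-- With u = √|x|, v = √|y|, w = √|x±y| this is an upper bound for |x±y|^(5/2). Expand w⁵ ≤
(u²+v²)²w and use uw ≤ u² + v²/2. The coefficient 1 of u⁵ and v⁵ matters: the later absorption has
little room. -/
theorem pow_five_le_of_sq_le {u v w : ℝ} (hu : 0 ≤ u) (hv : 0 ≤ v) (hw : 0 ≤ w)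
    (h : w ^ 2 ≤ u ^ 2 + v ^ 2) :
    w ^ 5 ≤ u ^ 5 + v ^ 5 + 5 / 2 * (u ^ 3 * v ^ 2 + u ^ 2 * v ^ 3) := by
  have h4 : w ^ 4 ≤ (u ^ 2 + v ^ 2) ^ 2 := by
    rw [show w ^ 4 = (w ^ 2) ^ 2 by ring]
    gcongr
  have h5 : w ^ 5 ≤ (u ^ 2 + v ^ 2) ^ 2 * w := by
    rw [show w ^ 5 = w ^ 4 * w by ring]
    gcongr
  have hwu : u * w ≤ u ^ 2 + v ^ 2 / 2 := by nlinarith [sq_nonneg (u - w)]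
  have hwv : v * w ≤ v ^ 2 + u ^ 2 / 2 := by nlinarith [sq_nonneg (v - w)]
  have hws : w ≤ u + v := by
    refine abs_le_of_sq_le_sq' ?_ (by positivity) |>.2
    nlinarith [mul_nonneg hu hv]
  have a1 : u ^ 3 * (u * w) ≤ u ^ 3 * (u ^ 2 + v ^ 2 / 2) := by gcongr
  have a2 : v ^ 3 * (v * w) ≤ v ^ 3 * (v ^ 2 + u ^ 2 / 2) := by gcongr
  have a3 : 2 * u ^ 2 * v ^ 2 * w ≤ 2 * u ^ 2 * v ^ 2 * (u + v) := by gcongr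
  nlinarith

/-- For v ≤ u one has w ≤ u, hence uw ≥ w² = u² - v²; insert this into w⁵ = (u²-v²)²w. It bounds
|x-y|^(5/2) from below, again with leading coefficients 1. -/
theorem le_pow_five_of_sq_eq {u v w : ℝ} (hu : 0 ≤ u) (hv : 0 ≤ v) (hw : 0 ≤ w)
    (h : w ^ 2 = |u ^ 2 - v ^ 2|) :
    u ^ 5 + v ^ 5 - 3 * (u ^ 3 * v ^ 2 + u ^ 2 * v ^ 3) ≤ w ^ 5 := by
  wlog huv : v ≤ u generalizing u v with H
  · have := H hv hu (by rw [h, abs_sub_comm]) (le_of_not_ge huv)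
    linarith
  have h2 : w ^ 2 = u ^ 2 - v ^ 2 := by
    rw [h, abs_of_nonneg]
    nlinarith
  have hwu : w ≤ u := abs_le_of_sq_le_sq' (by nlinarith) hu |>.2
  have h5 : w ^ 5 = (u ^ 2 - v ^ 2) ^ 2 * w := by rw [← h2]; ring
  have a1 : u ^ 3 * (u ^ 2 - v ^ 2) ≤ u ^ 3 * (u * w) := by
    gcongr
    nlinarith
  have a2 : u ^ 2 * v ^ 2 * w ≤ u ^ 2 * v ^ 2 * u := by gcongr
  have a3 : 0 ≤ v ^ 4 * w := by positivity
  have a4 : v ^ 3 * v ^ 2 ≤ v ^ 3 * u ^ 2 := by gcongr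
  have a5 : 0 ≤ u ^ 2 * v ^ 3 := by positivity
  rw [h5]
  nlinarith

theorem sqrt_abs_sub_sq_le (x y : ℝ) : √|x - y| ^ 2 ≤ √|x| ^ 2 + √|y| ^ 2 := by
  simp only [Real.sq_sqrt (abs_nonneg _)]
  exact abs_sub _ _

theorem sqrt_abs_add_sq_le (x y : ℝ) : √|x + y| ^ 2 ≤ √|x| ^ 2 + √|y| ^ 2 := by
  simp only [Real.sq_sqrt (abs_nonneg _)]
  exact abs_add_le _ _

theorem sqrt_abs_sub_pow_five_ge (x y : ℝ) :
    √|x| ^ 5 + √|y| ^ 5 - 3 * (√|x| ^ 3 * √|y| ^ 2 + √|x| ^ 2 * √|y| ^ 3) ≤ √|x - y| ^ 5 := by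
  have := le_pow_five_of_sq_eq (u := √|x|) (v := √|y|) (w := √(|(|x| - |y|)|)) (by positivity)
    (by positivity) (by positivity) (by simp only [Real.sq_sqrt (abs_nonneg _)])
  refine this.trans ?_
  exact pow_le_pow_left₀ (Real.sqrt_nonneg _)
    (Real.sqrt_le_sqrt (abs_abs_sub_abs_le x y)) 5

theorem rpow_le_one_add_sqrt {t γ : ℝ} (ht : 0 ≤ t) (h0 : 0 ≤ γ) (h1 : γ ≤ 1 / 2) :
    t ^ γ ≤ 1 + √t := by
  rcases le_total t 1 with h | h
  · have := Real.rpow_le_one ht h h0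
    have := Real.sqrt_nonneg t
    linarith
  · have := Real.rpow_le_rpow_of_exponent_le h h1
    rw [← Real.sqrt_eq_rpow] at this
    linarith

theorem abs_sub_rpow_le_sqrt {γ : ℝ} (h0 : 0 ≤ γ) (h1 : γ ≤ 1 / 2) (x y : ℝ) :
    |x - y| ^ γ ≤ 1 + (√|x| + √|y|) := by
  have h2 := rpow_le_one_add_sqrt (abs_nonneg (x - y)) h0 h1
  have h3 : √|x - y| ≤ √|x| + √|y| := by
    refine abs_le_of_sq_le_sq' ?_ (by positivity) |>.2
    have := sqrt_abs_sub_sq_le x y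
    nlinarith [mul_nonneg (Real.sqrt_nonneg |x|) (Real.sqrt_nonneg |y|)]
  linarith

/-! ### Uniform bounds on the energy and on the 5/2 moment -/

namespace SteadyMeasure

variable {γ : ℝ} {m : Measure ℝ}

theorem integrable_sqrt_pow (h : SteadyMeasure γ m) {k : ℕ} (hk : k ≤ 5) :
    Integrable (fun x : ℝ => √|x| ^ k) m := by
  have hk' : (k : ℝ) ≤ 5 := by exact_mod_cast hk
  refine (h.integrable_rpow ((k : ℝ) / 2) (by positivity) (by linarith)).congr
    (Eventually.of_forall fun x => abs_rpow_half x k)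

theorem integrable_abs (h : SteadyMeasure γ m) : Integrable (fun x : ℝ => |x|) m := by
  simpa using h.integrable_rpow 1 zero_le_one (by norm_num)

theorem integrable_sqrt_pow_mul (h : SteadyMeasure γ m) {i j : ℕ} (hi : i ≤ 5) (hj : j ≤ 5) :
    Integrable (fun p : ℝ × ℝ => √|p.1| ^ i * √|p.2| ^ j) (m.prod m) := by
  have := h.prob
  exact (h.integrable_sqrt_pow hi).mul_prod (h.integrable_sqrt_pow hj)

theorem integrable_sqrt_pow_mul_kernel (h : SteadyMeasure γ m) (h0 : 0 ≤ γ) (h1 : γ < 1 / 2)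
    {i j : ℕ} (hi : i ≤ 5) (hj : j ≤ 5) :
    Integrable (fun p : ℝ × ℝ => √|p.1| ^ i * √|p.2| ^ j * |p.1 - p.2| ^ γ) (m.prod m) := by
  have hi' : (i : ℝ) ≤ 5 := by exact_mod_cast hi
  have hj' : (j : ℝ) ≤ 5 := by exact_mod_cast hj
  have i1 := h.integrable_prod_rpow (a := (i : ℝ) / 2 + γ) (b := (j : ℝ) / 2) (by positivity)
    (by positivity) (by linarith) (by linarith)
  have i2 := h.integrable_prod_rpow (a := (i : ℝ) / 2) (b := (j : ℝ) / 2 + γ) (by positivity)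
    (by positivity) (by linarith) (by linarith)
  refine (i1.add i2).mono' ?_ (Eventually.of_forall fun p => ?_)
  · refine Measurable.aestronglyMeasurable (Measurable.mul (Continuous.measurable ?_)
      (measurable_abs_sub_rpow γ))
    fun_prop
  · rw [Real.norm_eq_abs, abs_of_nonneg (by positivity)]
    simp only [Pi.add_apply, Real.rpow_add_of_nonneg (abs_nonneg _)
      (show (0 : ℝ) ≤ (i : ℝ) / 2 by positivity) h0, Real.rpow_add_of_nonneg (abs_nonneg _)
      (show (0 : ℝ) ≤ (j : ℝ) / 2 by positivity) h0, abs_rpow_half]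
    calc _ ≤ √|p.1| ^ i * √|p.2| ^ j * (|p.1| ^ γ + |p.2| ^ γ) := by
          gcongr
          exact abs_sub_rpow_le_add h0 (by linarith) _ _
      _ = _ := by ring

theorem integral_sqrt_pow_mul (h : SteadyMeasure γ m) (i j : ℕ) :
    ∫ p : ℝ × ℝ, √|p.1| ^ i * √|p.2| ^ j ∂(m.prod m) =
      (∫ x : ℝ, √|x| ^ i ∂m) * ∫ x : ℝ, √|x| ^ j ∂m := by
  have := h.prob
  exact integral_prod_mul (fun x : ℝ => √|x| ^ i) (fun x : ℝ => √|x| ^ j)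

theorem integrable_sum_five_kernel (h : SteadyMeasure γ m) (h0 : 0 ≤ γ) (h1 : γ < 1 / 2) :
    Integrable (fun p : ℝ × ℝ => (√|p.1| ^ 5 + √|p.2| ^ 5) * |p.1 - p.2| ^ γ) (m.prod m) := by
  refine ((h.integrable_sqrt_pow_mul_kernel h0 h1 (i := 5) (j := 0) le_rfl (by norm_num)).add
    (h.integrable_sqrt_pow_mul_kernel h0 h1 (i := 0) (j := 5) (by norm_num) le_rfl)).congr
    (Eventually.of_forall fun p => ?_)
  simp only [Pi.add_apply]
  ring

theorem integrable_sum_five (h : SteadyMeasure γ m) :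
    Integrable (fun p : ℝ × ℝ => √|p.1| ^ 5 + √|p.2| ^ 5) (m.prod m) := by
  have := h.prob
  exact integrable_prod_add (h.integrable_sqrt_pow le_rfl) (h.integrable_sqrt_pow le_rfl)

theorem integrable_cross_kernel (h : SteadyMeasure γ m) (h0 : 0 ≤ γ) (h1 : γ < 1 / 2) :
    Integrable (fun p : ℝ × ℝ => (√|p.1| ^ 3 * √|p.2| ^ 2 + √|p.1| ^ 2 * √|p.2| ^ 3) *
      |p.1 - p.2| ^ γ) (m.prod m) := by
  refine ((h.integrable_sqrt_pow_mul_kernel h0 h1 (i := 3) (j := 2) (by norm_num)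
    (by norm_num)).add (h.integrable_sqrt_pow_mul_kernel h0 h1 (i := 2) (j := 3) (by norm_num)
    (by norm_num))).congr (Eventually.of_forall fun p => ?_)
  simp only [Pi.add_apply]
  ring

theorem integrable_cross (h : SteadyMeasure γ m) :
    Integrable (fun p : ℝ × ℝ => √|p.1| ^ 3 * √|p.2| ^ 2 + √|p.1| ^ 2 * √|p.2| ^ 3)
      (m.prod m) :=
  (h.integrable_sqrt_pow_mul (by norm_num) (by norm_num)).add
    (h.integrable_sqrt_pow_mul (by norm_num) (by norm_num))

theorem integrable_sub_five (h : SteadyMeasure γ m) :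
    Integrable (fun p : ℝ × ℝ => √|p.1 - p.2| ^ 5) (m.prod m) := by
  refine (h.integrable_sum_five.add (h.integrable_cross.const_mul (5 / 2))).mono'
    (Continuous.aestronglyMeasurable (by fun_prop)) (Eventually.of_forall fun p => ?_)
  rw [Real.norm_eq_abs, abs_of_nonneg (by positivity)]
  exact pow_five_le_of_sq_le (by positivity) (by positivity) (by positivity)
    (sqrt_abs_sub_sq_le _ _)

theorem integrable_sub_five_kernel (h : SteadyMeasure γ m) (h0 : 0 ≤ γ) (h1 : γ < 1 / 2) :
    Integrable (fun p : ℝ × ℝ => √|p.1 - p.2| ^ 5 * |p.1 - p.2| ^ γ) (m.prod m) := by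
  refine ((h.integrable_sum_five_kernel h0 h1).add
    ((h.integrable_cross_kernel h0 h1).const_mul (5 / 2))).mono'
    (Measurable.aestronglyMeasurable (Measurable.mul (Continuous.measurable (by fun_prop))
      (measurable_abs_sub_rpow γ))) (Eventually.of_forall fun p => ?_)
  rw [Real.norm_eq_abs, abs_of_nonneg (by positivity)]
  have := pow_five_le_of_sq_le (u := √|p.1|) (v := √|p.2|) (by positivity) (by positivity)
    (by positivity) (sqrt_abs_sub_sq_le p.1 p.2)
  have := mul_le_mul_of_nonneg_right this (show 0 ≤ |p.1 - p.2| ^ γ by positivity)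
  simp only [Pi.add_apply]
  linarith

theorem integrable_add_five_kernel (h : SteadyMeasure γ m) (h0 : 0 ≤ γ) (h1 : γ < 1 / 2) :
    Integrable (fun p : ℝ × ℝ => √|p.1 + p.2| ^ 5 * |p.1 - p.2| ^ γ) (m.prod m) := by
  refine ((h.integrable_sum_five_kernel h0 h1).add
    ((h.integrable_cross_kernel h0 h1).const_mul (5 / 2))).mono'
    (Measurable.aestronglyMeasurable (Measurable.mul (Continuous.measurable (by fun_prop))
      (measurable_abs_sub_rpow γ))) (Eventually.of_forall fun p => ?_)
  rw [Real.norm_eq_abs, abs_of_nonneg (by positivity)]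
  have := pow_five_le_of_sq_le (u := √|p.1|) (v := √|p.2|) (by positivity) (by positivity)
    (by positivity) (sqrt_abs_add_sq_le p.1 p.2)
  have := mul_le_mul_of_nonneg_right this (show 0 ≤ |p.1 - p.2| ^ γ by positivity)
  simp only [Pi.add_apply]
  linarith

theorem integrable_sq (h : SteadyMeasure γ m) : Integrable (fun x : ℝ => x ^ 2) m :=
  (h.integrable_sqrt_pow (k := 4) (by norm_num)).congr
    (Eventually.of_forall fun x => sqrt_abs_pow_four x)

theorem integrable_id (h : SteadyMeasure γ m) : Integrable (fun x : ℝ => x) m :=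
  h.integrable_abs.mono (by fun_prop) (Eventually.of_forall fun x => by simp)

theorem integrable_sub_sq (h : SteadyMeasure γ m) :
    Integrable (fun p : ℝ × ℝ => (p.1 - p.2) ^ 2) (m.prod m) := by
  have := h.prob
  refine ((integrable_prod_add h.integrable_sq h.integrable_sq).sub
    ((h.integrable_id.mul_prod h.integrable_id).const_mul 2)).congr
    (Eventually.of_forall fun p => ?_)
  simp only [Pi.sub_apply]
  ring

theorem integral_sub_sq (h : SteadyMeasure γ m) :
    ∫ p : ℝ × ℝ, (p.1 - p.2) ^ 2 ∂(m.prod m) = 2 * ∫ x : ℝ, x ^ 2 ∂m := by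
  have := h.prob
  have e : ∀ p : ℝ × ℝ, (p.1 - p.2) ^ 2 = (p.1 ^ 2 + p.2 ^ 2) - 2 * (p.1 * p.2) :=
    fun p => by ring
  simp only [e]
  rw [integral_sub (integrable_prod_add h.integrable_sq h.integrable_sq)
    ((h.integrable_id.mul_prod h.integrable_id).const_mul 2), integral_const_mul,
    integral_prod_mul (fun x : ℝ => x) (fun x : ℝ => x), h.mean,
    integral_add (h.integrable_sq.comp_fst m) (h.integrable_sq.comp_snd m),
    integral_fun_fst (fun x : ℝ => x ^ 2), integral_fun_snd (fun x : ℝ => x ^ 2)]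
  simp
  ring

theorem integrable_sub_sq_kernel (h : SteadyMeasure γ m) (h0 : 0 ≤ γ) (h1 : γ < 1 / 2) :
    Integrable (fun p : ℝ × ℝ => (p.1 - p.2) ^ 2 * |p.1 - p.2| ^ γ) (m.prod m) := by
  have h3 := h.integrable_moment_kernel (a := 2) (b := γ) (by norm_num) h0 (by linarith)
  refine (h3.const_mul 2).mono' (Measurable.aestronglyMeasurable (Measurable.mul
    (Continuous.measurable (by fun_prop)) (measurable_abs_sub_rpow γ)))
    (Eventually.of_forall fun p => ?_)
  rw [Real.norm_eq_abs, abs_of_nonneg (by positivity), ← mul_assoc]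
  simp only [Real.rpow_two, sq_abs]
  refine mul_le_mul ?_ (abs_sub_rpow_le_add h0 (by linarith) _ _) (by positivity) (by positivity)
  nlinarith [sq_nonneg (p.1 + p.2)]

theorem integral_sub_sq_kernel (h : SteadyMeasure γ m) (h0 : 0 ≤ γ) (h1 : γ < 1 / 2) :
    ∫ p : ℝ × ℝ, (p.1 - p.2) ^ 2 * |p.1 - p.2| ^ γ ∂(m.prod m) = 2 * ∫ x : ℝ, x ^ 2 ∂m := by
  have h2 := h.moment_identity h0 (by linarith) (s := 2) (by norm_num) (by linarith)
  have e : ∀ p : ℝ × ℝ, collisionDiff (fun t => |t| ^ (2 : ℝ)) p.1 p.2 * |p.1 - p.2| ^ γ =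
      -(1 / 2) * ((p.1 - p.2) ^ 2 * |p.1 - p.2| ^ γ) := by
    intro p
    simp only [collisionDiff, Real.rpow_two, sq_abs]
    ring
  simp only [e] at h2
  simp only [Real.rpow_two, sq_abs] at h2
  rw [integral_const_mul] at h2
  linarith

theorem integrable_sub_five_sub_sq (h : SteadyMeasure γ m) :
    Integrable (fun p : ℝ × ℝ => √|p.1 - p.2| ^ 5 - (p.1 - p.2) ^ 2) (m.prod m) :=
  h.integrable_sub_five.sub h.integrable_sub_sq

/-- Bernoulli's inequality for t^(1+γ/2) at t = |x-y|², integrated; since ∬t^(1+γ/2) = ∬t = 2M₂,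
what remains is (γ/2)·2M₂ ≤ γ/2. -/
theorem energy_le_half (h : SteadyMeasure γ m) (h0 : 0 < γ) (h1 : γ < 1 / 2) :
    ∫ x : ℝ, x ^ 2 ∂m ≤ 1 / 2 := by
  have := h.prob
  have i1 : Integrable (fun p : ℝ × ℝ => (p.1 - p.2) ^ 2 - 1) (m.prod m) :=
    h.integrable_sub_sq.sub (integrable_const 1)
  have hle : ∫ p : ℝ × ℝ, (1 + (1 + γ / 2) * ((p.1 - p.2) ^ 2 - 1)) ∂(m.prod m) ≤
      ∫ p : ℝ × ℝ, (p.1 - p.2) ^ 2 * |p.1 - p.2| ^ γ ∂(m.prod m) := by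
    refine integral_mono ((integrable_const 1).add (i1.const_mul _))
      (h.integrable_sub_sq_kernel h0.le h1) fun p => ?_
    have hb := one_add_mul_self_le_rpow_one_add (s := (p.1 - p.2) ^ 2 - 1)
      (by nlinarith [sq_nonneg (p.1 - p.2)]) (p := 1 + γ / 2) (by linarith)
    refine hb.trans (le_of_eq ?_)
    rw [add_sub_cancel, Real.rpow_one_add' (sq_nonneg _) (by positivity), ← sq_abs,
      ← Real.rpow_natCast_mul (abs_nonneg _)]
    congr 2
    push_cast
    ring
  rw [h.integral_sub_sq_kernel h0.le h1, integral_add (integrable_const 1) (i1.const_mul _), integral_const_mul,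
    integral_sub h.integrable_sub_sq (integrable_const 1), h.integral_sub_sq] at hle
  simp at hle
  have : γ / 2 * (2 * ∫ x : ℝ, x ^ 2 ∂m) ≤ γ / 2 * 1 := by linarith
  have := le_of_mul_le_mul_left this (by linarith)
  linarith

/-- Concave Bernoulli, t^γ ≤ 1 + 2γ(√t - 1), is integrated against t² with t = |x-y|, and the factor
2γ cancels. This excludes collapse of the energy: the right side is of higher order in the size of
m. -/
theorem two_mul_energy_le (h : SteadyMeasure γ m) (h0 : 0 < γ) (h1 : γ < 1 / 2) :
    2 * ∫ x : ℝ, x ^ 2 ∂m ≤ ∫ p : ℝ × ℝ, √|p.1 - p.2| ^ 5 ∂(m.prod m) := by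
  have := h.prob
  have hle : ∫ p : ℝ × ℝ, (p.1 - p.2) ^ 2 * |p.1 - p.2| ^ γ ∂(m.prod m) ≤
      ∫ p : ℝ × ℝ, ((p.1 - p.2) ^ 2 + 2 * γ * (√|p.1 - p.2| ^ 5 - (p.1 - p.2) ^ 2))
        ∂(m.prod m) := by
    refine integral_mono (h.integrable_sub_sq_kernel h0.le h1) (h.integrable_sub_sq.add
      (h.integrable_sub_five_sub_sq.const_mul _)) fun p => ?_
    simp only
    have hb := rpow_one_add_le_one_add_mul_self (s := √|p.1 - p.2| - 1)
      (by linarith [Real.sqrt_nonneg |p.1 - p.2|]) (p := 2 * γ) (by linarith) (by linarith)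
    rw [add_sub_cancel, Real.sqrt_eq_rpow, ← Real.rpow_mul (abs_nonneg _),
      show 1 / 2 * (2 * γ) = γ by ring, ← Real.sqrt_eq_rpow] at hb
    have h5 : √|p.1 - p.2| ^ 5 = (p.1 - p.2) ^ 2 * √|p.1 - p.2| := by
      rw [← sqrt_abs_pow_four]; ring
    rw [h5]
    have := mul_le_mul_of_nonneg_left hb (sq_nonneg (p.1 - p.2))
    linarith
  rw [h.integral_sub_sq_kernel h0.le h1, integral_add h.integrable_sub_sq
    (h.integrable_sub_five_sub_sq.const_mul _), integral_const_mul,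
    integral_sub h.integrable_sub_five h.integrable_sub_sq, h.integral_sub_sq] at hle
  have : 2 * γ * (2 * ∫ x : ℝ, x ^ 2 ∂m) ≤
      2 * γ * ∫ p : ℝ × ℝ, √|p.1 - p.2| ^ 5 ∂(m.prod m) := by linarith
  exact le_of_mul_le_mul_left this (by linarith)

/-- Chebyshev's correlation trick: √t - 1 and t^γ - 1 have the same sign. Multiply by t² and
integrate; the two lower-order terms cancel because ∬t^(2+γ) = ∬t². -/
theorem sub_five_le_sub_five_kernel (h : SteadyMeasure γ m) (h0 : 0 ≤ γ) (h1 : γ < 1 / 2) :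
    ∫ p : ℝ × ℝ, √|p.1 - p.2| ^ 5 ∂(m.prod m) ≤
      ∫ p : ℝ × ℝ, √|p.1 - p.2| ^ 5 * |p.1 - p.2| ^ γ ∂(m.prod m) := by
  have hle : ∫ p : ℝ × ℝ, ((√|p.1 - p.2| ^ 5 - (p.1 - p.2) ^ 2) +
        (p.1 - p.2) ^ 2 * |p.1 - p.2| ^ γ) ∂(m.prod m) ≤
      ∫ p : ℝ × ℝ, √|p.1 - p.2| ^ 5 * |p.1 - p.2| ^ γ ∂(m.prod m) := by
    refine integral_mono (h.integrable_sub_five_sub_sq.add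
      (h.integrable_sub_sq_kernel h0 h1)) (h.integrable_sub_five_kernel h0 h1) fun p => ?_
    simp only
    have h5 : √|p.1 - p.2| ^ 5 = (p.1 - p.2) ^ 2 * √|p.1 - p.2| := by
      rw [← sqrt_abs_pow_four]; ring
    have hp : 0 ≤ (√|p.1 - p.2| - 1) * (|p.1 - p.2| ^ γ - 1) := by
      rcases le_total |p.1 - p.2| 1 with h3 | h3
      · have a1 := Real.rpow_le_one (abs_nonneg _) h3 h0
        have a2 : √|p.1 - p.2| ≤ 1 := Real.sqrt_le_one.2 h3
        nlinarith
      · have a1 := Real.one_le_rpow h3 h0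
        have a2 : 1 ≤ √|p.1 - p.2| := Real.one_le_sqrt.2 h3
        nlinarith
    rw [h5]
    have := mul_nonneg (sq_nonneg (p.1 - p.2)) hp
    linarith
  rw [integral_add h.integrable_sub_five_sub_sq
    (h.integrable_sub_sq_kernel h0 h1), integral_sub h.integrable_sub_five h.integrable_sub_sq,
    h.integral_sub_sq, h.integral_sub_sq_kernel h0 h1] at hle
  linarith

theorem integral_sum_five (h : SteadyMeasure γ m) :
    ∫ p : ℝ × ℝ, (√|p.1| ^ 5 + √|p.2| ^ 5) ∂(m.prod m) = 2 * ∫ x : ℝ, √|x| ^ 5 ∂m := by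
  have := h.prob
  have i := h.integrable_sqrt_pow (k := 5) le_rfl
  rw [integral_add (i.comp_fst m) (i.comp_snd m), integral_fun_fst (fun x : ℝ => √|x| ^ 5),
    integral_fun_snd (fun x : ℝ => √|x| ^ 5)]
  simp
  ring

theorem integral_cross (h : SteadyMeasure γ m) :
    ∫ p : ℝ × ℝ, (√|p.1| ^ 3 * √|p.2| ^ 2 + √|p.1| ^ 2 * √|p.2| ^ 3) ∂(m.prod m) =
      2 * ((∫ x : ℝ, √|x| ^ 3 ∂m) * ∫ x : ℝ, √|x| ^ 2 ∂m) := by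
  rw [integral_add (h.integrable_sqrt_pow_mul (by norm_num) (by norm_num))
    (h.integrable_sqrt_pow_mul (by norm_num) (by norm_num)), h.integral_sqrt_pow_mul,
    h.integral_sqrt_pow_mul]
  ring

theorem integral_cross_kernel_le (h : SteadyMeasure γ m) (h0 : 0 ≤ γ) (h1 : γ < 1 / 2) :
    ∫ p : ℝ × ℝ, (√|p.1| ^ 3 * √|p.2| ^ 2 + √|p.1| ^ 2 * √|p.2| ^ 3) * |p.1 - p.2| ^ γ
        ∂(m.prod m) ≤
      2 * ((∫ x : ℝ, √|x| ^ 3 ∂m) * ∫ x : ℝ, √|x| ^ 2 ∂m) +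
      2 * ((∫ x : ℝ, √|x| ^ 4 ∂m) * ∫ x : ℝ, √|x| ^ 2 ∂m) + 2 * (∫ x : ℝ, √|x| ^ 3 ∂m) ^ 2 := by
  have i1 := h.integrable_cross
  have i2 := h.integrable_sqrt_pow_mul (i := 4) (j := 2) (by norm_num) (by norm_num)
  have i3 := h.integrable_sqrt_pow_mul (i := 2) (j := 4) (by norm_num) (by norm_num)
  have i4 := h.integrable_sqrt_pow_mul (i := 3) (j := 3) (by norm_num) (by norm_num)
  have i23 : Integrable (fun p : ℝ × ℝ => √|p.1| ^ 4 * √|p.2| ^ 2 + √|p.1| ^ 2 * √|p.2| ^ 4)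
    (m.prod m) := i2.add i3
  have i234 : Integrable (fun p : ℝ × ℝ => √|p.1| ^ 4 * √|p.2| ^ 2 + √|p.1| ^ 2 * √|p.2| ^ 4 +
    2 * (√|p.1| ^ 3 * √|p.2| ^ 3)) (m.prod m) := i23.add (i4.const_mul 2)
  calc _ ≤ ∫ p : ℝ × ℝ, ((√|p.1| ^ 3 * √|p.2| ^ 2 + √|p.1| ^ 2 * √|p.2| ^ 3) +
        (√|p.1| ^ 4 * √|p.2| ^ 2 + √|p.1| ^ 2 * √|p.2| ^ 4 + 2 * (√|p.1| ^ 3 * √|p.2| ^ 3)))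
        ∂(m.prod m) := by
        refine integral_mono (h.integrable_cross_kernel h0 h1) (i1.add i234) fun p => ?_
        calc _ ≤ (√|p.1| ^ 3 * √|p.2| ^ 2 + √|p.1| ^ 2 * √|p.2| ^ 3) *
              (1 + (√|p.1| + √|p.2|)) := by
              gcongr
              exact abs_sub_rpow_le_sqrt h0 h1.le _ _
          _ = _ := by ring
    _ = _ := by
      rw [integral_add i1 i234, integral_add i23 (i4.const_mul 2), integral_add i2 i3,
        integral_const_mul, h.integral_cross, h.integral_sqrt_pow_mul, h.integral_sqrt_pow_mul,
        h.integral_sqrt_pow_mul]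
      ring

/-- The identity for |x|^(5/2) bounds the weighted moment `Pk` by (5/4)S/(1-2c) plus cross terms, c
= 2^(-5/2). Conversely 2S ≤ `Pk` plus cross terms, by the lower bound for |x-y|^(5/2) and the
correlation inequality. Since (5/4)/(1-2c) ≈ 1.93 < 2, S can be absorbed. -/
theorem integral_five_le_cross (h : SteadyMeasure γ m) (h0 : 0 ≤ γ) (h1 : γ < 1 / 2) :
    ∫ x : ℝ, √|x| ^ 5 ∂m ≤
      48 * ∫ p : ℝ × ℝ, (√|p.1| ^ 3 * √|p.2| ^ 2 + √|p.1| ^ 2 * √|p.2| ^ 3) ∂(m.prod m) +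
      60 * ∫ p : ℝ × ℝ, (√|p.1| ^ 3 * √|p.2| ^ 2 + √|p.1| ^ 2 * √|p.2| ^ 3) * |p.1 - p.2| ^ γ
        ∂(m.prod m) := by
  have iP := h.integrable_sum_five
  have iPk := h.integrable_sum_five_kernel h0 h1
  have iK := h.integrable_cross
  have iKk := h.integrable_cross_kernel h0 h1
  set S := ∫ x : ℝ, √|x| ^ 5 ∂m
  set K := ∫ p : ℝ × ℝ, (√|p.1| ^ 3 * √|p.2| ^ 2 + √|p.1| ^ 2 * √|p.2| ^ 3) ∂(m.prod m) with hK
  set Kk := ∫ p : ℝ × ℝ, (√|p.1| ^ 3 * √|p.2| ^ 2 + √|p.1| ^ 2 * √|p.2| ^ 3) * |p.1 - p.2| ^ γ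
        ∂(m.prod m) with hKk
  set Pk := ∫ p : ℝ × ℝ, (√|p.1| ^ 5 + √|p.2| ^ 5) * |p.1 - p.2| ^ γ ∂(m.prod m) with hPk
  have hK0 : 0 ≤ K := integral_nonneg fun p => by positivity
  have hKk0 : 0 ≤ Kk := integral_nonneg fun p => by positivity
  have hPk0 : 0 ≤ Pk := integral_nonneg fun p => by positivity
  have hmid : ∫ p : ℝ × ℝ, √|p.1 + p.2| ^ 5 * |p.1 - p.2| ^ γ ∂(m.prod m) ≤
      Pk + 5 / 2 * Kk := by
    rw [hPk, hKk, ← integral_const_mul, ← integral_add iPk (iKk.const_mul _)]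
    refine integral_mono (h.integrable_add_five_kernel h0 h1) (iPk.add (iKk.const_mul _))
      fun p => ?_
    have := pow_five_le_of_sq_le (u := √|p.1|) (v := √|p.2|) (by positivity) (by positivity)
      (by positivity) (sqrt_abs_add_sq_le p.1 p.2)
    have := mul_le_mul_of_nonneg_right this (show 0 ≤ |p.1 - p.2| ^ γ by positivity)
    simp only
    linarith
  have hsub : ∫ p : ℝ × ℝ, √|p.1 - p.2| ^ 5 * |p.1 - p.2| ^ γ ∂(m.prod m) ≤
      Pk + 5 / 2 * Kk := by
    rw [hPk, hKk, ← integral_const_mul, ← integral_add iPk (iKk.const_mul _)]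
    refine integral_mono (h.integrable_sub_five_kernel h0 h1) (iPk.add (iKk.const_mul _))
      fun p => ?_
    have := pow_five_le_of_sq_le (u := √|p.1|) (v := √|p.2|) (by positivity) (by positivity)
      (by positivity) (sqrt_abs_sub_sq_le p.1 p.2)
    have := mul_le_mul_of_nonneg_right this (show 0 ≤ |p.1 - p.2| ^ γ by positivity)
    simp only
    linarith
  have hlow : 2 * S - 3 * K ≤ ∫ p : ℝ × ℝ, √|p.1 - p.2| ^ 5 ∂(m.prod m) := by
    rw [← h.integral_sum_five, hK, ← integral_const_mul, ← integral_sub iP (iK.const_mul _)]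
    exact integral_mono (iP.sub (iK.const_mul _)) h.integrable_sub_five
      fun p => sqrt_abs_sub_pow_five_ge p.1 p.2
  have hmono := h.sub_five_le_sub_five_kernel h0 h1
  set c : ℝ := (√2 ^ 5)⁻¹ with hc
  have hc0 : 0 < c := by positivity
  -- c ≈ 0.1768; the sharp rounding is needed, as the absorption only requires 2c < 3/8 but the
  -- constants 48 and 60 leave little slack.
  have hc1 : c ≤ 0.177 := by
    rw [hc, inv_le_comm₀ (by positivity) (by norm_num)]
    have h2 : √2 ^ 5 = 4 * √2 := by
      rw [show √2 ^ 5 = (√2 ^ 2) ^ 2 * √2 by ring, Real.sq_sqrt (by norm_num)]; norm_num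
    rw [h2]
    have : (1.4141 : ℝ) ≤ √2 := Real.le_sqrt_of_sq_le (by norm_num)
    norm_num at this ⊢
    linarith
  have hid := h.moment_identity h0 (by linarith) (s := 5 / 2) (by norm_num) (by linarith)
  have e5 : ∀ t : ℝ, |t| ^ ((5 : ℝ) / 2) = √|t| ^ 5 := fun t => by
    exact_mod_cast abs_rpow_half t 5
  have e : ∀ p : ℝ × ℝ, collisionDiff (fun t => |t| ^ ((5 : ℝ) / 2)) p.1 p.2 *
      |p.1 - p.2| ^ γ = 2 * c * (√|p.1 + p.2| ^ 5 * |p.1 - p.2| ^ γ) -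
      (√|p.1| ^ 5 + √|p.2| ^ 5) * |p.1 - p.2| ^ γ := by
    intro p
    have hd : √|(p.1 + p.2) / 2| ^ 5 = √|p.1 + p.2| ^ 5 * c := by
      rw [abs_div, abs_two, Real.sqrt_div (abs_nonneg _), div_pow, hc, div_eq_mul_inv]
    simp only [collisionDiff, e5, hd]
    ring
  simp only [e] at hid
  simp only [e5] at hid
  rw [integral_sub ((h.integrable_add_five_kernel h0 h1).const_mul _) iPk, integral_const_mul,
    ← hPk] at hid
  have a1 : c * ∫ p : ℝ × ℝ, √|p.1 + p.2| ^ 5 * |p.1 - p.2| ^ γ ∂(m.prod m) ≤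
      0.177 * (Pk + 5 / 2 * Kk) := by
    refine (mul_le_mul_of_nonneg_left hmid hc0.le).trans ?_
    gcongr
  change -(1 / 4) * (5 / 2 * S) = _ at hid
  linarith

/-- Hölder interpolation by AM-GM: 2e²|x| ≤ e⁴ + x², then 2e|x|^(3/2) ≤ e²|x| + x². Using e =
M₂^(1/4) keeps all moments as integer powers of e. -/
theorem moment_interpolation (h : SteadyMeasure γ m) {e : ℝ} (he : 0 < e)
    (h4 : ∫ x : ℝ, x ^ 2 ∂m = e ^ 4) :
    ∫ x : ℝ, √|x| ^ 2 ∂m ≤ e ^ 2 ∧ ∫ x : ℝ, √|x| ^ 3 ∂m ≤ e ^ 3 := by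
  have := h.prob
  have h4' : ∫ x : ℝ, √|x| ^ 4 ∂m = e ^ 4 := by
    simp only [sqrt_abs_pow_four, h4]
  have i2 := h.integrable_sqrt_pow (k := 2) (by norm_num)
  have i3 := h.integrable_sqrt_pow (k := 3) (by norm_num)
  have i4 := h.integrable_sqrt_pow (k := 4) (by norm_num)
  have b2 : ∫ x : ℝ, 2 * e ^ 2 * √|x| ^ 2 ∂m ≤ ∫ x : ℝ, (e ^ 4 + √|x| ^ 4) ∂m := by
    refine integral_mono (i2.const_mul _) ((integrable_const _).add i4) fun x => ?_
    simp only
    nlinarith [sq_nonneg (e ^ 2 - √|x| ^ 2)]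
  have b3 : ∫ x : ℝ, 2 * e * √|x| ^ 3 ∂m ≤ ∫ x : ℝ, (e ^ 2 * √|x| ^ 2 + √|x| ^ 4) ∂m := by
    refine integral_mono (i3.const_mul _) ((i2.const_mul _).add i4) fun x => ?_
    simp only
    nlinarith [sq_nonneg (√|x| * (e - √|x|))]
  rw [integral_const_mul, integral_add (integrable_const _) i4, h4'] at b2
  rw [integral_const_mul, integral_add (i2.const_mul _) i4, h4', integral_const_mul] at b3
  simp at b2
  have c2 : ∫ x : ℝ, √|x| ^ 2 ∂m ≤ e ^ 2 := by
    have : 2 * e ^ 2 * ∫ x : ℝ, √|x| ^ 2 ∂m ≤ 2 * e ^ 2 * e ^ 2 := by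
      simp only [Real.sq_sqrt (abs_nonneg _)]
      nlinarith
    exact le_of_mul_le_mul_left this (by positivity)
  refine ⟨c2, ?_⟩
  have : 2 * e * ∫ x : ℝ, √|x| ^ 3 ∂m ≤ 2 * e * e ^ 3 := by
    have := mul_le_mul_of_nonneg_left c2 (show 0 ≤ e ^ 2 by positivity)
    nlinarith
  exact le_of_mul_le_mul_left this (by positivity)

/-- Absolute continuity excludes the Dirac mass at the origin. -/
theorem energy_pos (h : SteadyMeasure γ m) : 0 < ∫ x : ℝ, x ^ 2 ∂m := by
  have := h.prob
  rw [integral_pos_iff_support_of_nonneg (fun x => sq_nonneg x) h.integrable_sq]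
  have hs : Function.support (fun x : ℝ => x ^ 2) = {0}ᶜ := by
    ext x
    simp
  rw [hs, prob_compl_eq_one_sub (measurableSet_singleton 0), h.ac (by simp)]
  simp

/-- Uniform bounds for the moments of steady measures. -/
theorem moment_bounds {E : ℝ} (hE : 0 < E) :
    ∃ c C : ℝ, 0 < c ∧ 0 < C ∧ ∀ γ : ℝ, 0 ≤ γ → γ < 1 / 2 → ∀ m : Measure ℝ, SteadyMeasure γ m →
      (γ = 0 → ∫ x : ℝ, x ^ 2 ∂m = E) →
      c ≤ ∫ x : ℝ, x ^ 2 ∂m ∧ ∫ x : ℝ, x ^ 2 ∂m ≤ C ∧ ∫ x : ℝ, √|x| ^ 5 ∂m ≤ C := by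
  set B : ℝ := max (1 / 2) E with hB
  have hB0 : 0 < B := by positivity
  set b : ℝ := √(√B) with hb
  -- 216 = 48·2 + 60·2 and 240 = 60·4 come from the cross-term bounds. For the lower bound, 2e⁴ ≤
  -- 2(216e⁵ + 240e⁶) + 5e⁵ ≤ 917e⁵ when e ≤ 1.
  refine ⟨min ((2 / 917) ^ 4) E, max B (216 * b ^ 5 + 240 * b ^ 6), by positivity, by positivity,
    fun γ h0 h1 m h hE' => ?_⟩
  have hpos := h.energy_pos
  have hMB : ∫ x : ℝ, x ^ 2 ∂m ≤ B := by
    rcases h0.eq_or_lt with h2 | h2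
    · rw [hE' h2.symm]; exact le_max_right _ _
    · exact (h.energy_le_half h2 h1).trans (le_max_left _ _)
  set e : ℝ := √(√(∫ x : ℝ, x ^ 2 ∂m)) with he
  have he0 : 0 < e := Real.sqrt_pos.2 (Real.sqrt_pos.2 hpos)
  have he4 : ∫ x : ℝ, x ^ 2 ∂m = e ^ 4 := by
    rw [he, show ∀ t : ℝ, t ^ 4 = (t ^ 2) ^ 2 from fun t => by ring,
      Real.sq_sqrt (Real.sqrt_nonneg _), Real.sq_sqrt hpos.le]
  have heb : e ≤ b := Real.sqrt_le_sqrt (Real.sqrt_le_sqrt hMB)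
  obtain ⟨m2, m3⟩ := h.moment_interpolation he0 he4
  have n2 : 0 ≤ ∫ x : ℝ, √|x| ^ 2 ∂m := integral_nonneg fun x => by positivity
  have n3 : 0 ≤ ∫ x : ℝ, √|x| ^ 3 ∂m := integral_nonneg fun x => by positivity
  have h4' : ∫ x : ℝ, √|x| ^ 4 ∂m = e ^ 4 := by
    simp only [sqrt_abs_pow_four, he4]
  have p32 : (∫ x : ℝ, √|x| ^ 3 ∂m) * ∫ x : ℝ, √|x| ^ 2 ∂m ≤ e ^ 5 := by
    calc _ ≤ e ^ 3 * e ^ 2 := by gcongr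
      _ = _ := by ring
  have p42 : (∫ x : ℝ, √|x| ^ 4 ∂m) * ∫ x : ℝ, √|x| ^ 2 ∂m ≤ e ^ 6 := by
    rw [h4']
    calc _ ≤ e ^ 4 * e ^ 2 := by gcongr
      _ = _ := by ring
  have p33 : (∫ x : ℝ, √|x| ^ 3 ∂m) ^ 2 ≤ e ^ 6 := by
    calc _ ≤ (e ^ 3) ^ 2 := by gcongr
      _ = _ := by ring
  have q1 := h.integral_cross
  have q2 := h.integral_cross_kernel_le h0 h1
  have hS : ∫ x : ℝ, √|x| ^ 5 ∂m ≤ 216 * e ^ 5 + 240 * e ^ 6 := by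
    have := h.integral_five_le_cross h0 h1
    linarith
  refine ⟨?_, hMB.trans (le_max_left _ _), hS.trans (le_trans (by gcongr) (le_max_right _ _))⟩
  rcases h0.eq_or_lt with h2 | h2
  · rw [hE' h2.symm]; exact min_le_right _ _
  refine (min_le_left _ _).trans ?_
  have hle := h.two_mul_energy_le h2 h1
  have hsub : ∫ p : ℝ × ℝ, √|p.1 - p.2| ^ 5 ∂(m.prod m) ≤
      2 * (∫ x : ℝ, √|x| ^ 5 ∂m) + 5 / 2 *
        ∫ p : ℝ × ℝ, (√|p.1| ^ 3 * √|p.2| ^ 2 + √|p.1| ^ 2 * √|p.2| ^ 3) ∂(m.prod m) := by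
    rw [← h.integral_sum_five, ← integral_const_mul,
      ← integral_add h.integrable_sum_five (h.integrable_cross.const_mul _)]
    refine integral_mono h.integrable_sub_five
      (h.integrable_sum_five.add (h.integrable_cross.const_mul _)) fun p => ?_
    exact pow_five_le_of_sq_le (by positivity) (by positivity) (by positivity)
      (sqrt_abs_sub_sq_le _ _)
  have he1 : e ≤ 1 := by
    have := h.energy_le_half h2 h1
    rw [he4] at this
    by_contra hcon
    have := one_lt_pow₀ (not_le.1 hcon) (n := 4) (by norm_num)
    linarith
  rw [he4] at hle ⊢
  have h65 : e ^ 6 ≤ e ^ 5 := pow_le_pow_of_le_one he0.le he1 (by norm_num)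
  have : 2 * e ^ 4 ≤ 917 * e * e ^ 4 := by
    calc 2 * e ^ 4 ≤ 917 * e ^ 5 := by linarith
      _ = _ := by ring
  have := le_of_mul_le_mul_right this (by positivity)
  gcongr
  linarith

end SteadyMeasure

/-! ### Trapezoidal test functions -/

/-- The even trapezoidal function equal to `1` for `|x| ≤ a` and to `0` for `b ≤ |x|`. -/
noncomputable def trapezoid (a b x : ℝ) : ℝ := max 0 (min 1 ((b - |x|) / (b - a)))

theorem trapezoid_nonneg (a b x : ℝ) : 0 ≤ trapezoid a b x := le_max_left _ _

theorem trapezoid_le_one (a b x : ℝ) : trapezoid a b x ≤ 1 :=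
  max_le zero_le_one (min_le_left _ _)

theorem trapezoid_eq_one {a b x : ℝ} (hab : a < b) (hx : |x| ≤ a) : trapezoid a b x = 1 := by
  have : 1 ≤ (b - |x|) / (b - a) := by
    rw [one_le_div (by linarith)]
    linarith
  rw [trapezoid, min_eq_left this, max_eq_right zero_le_one]

theorem trapezoid_eq_zero {a b x : ℝ} (hab : a < b) (hx : b ≤ |x|) : trapezoid a b x = 0 := by
  have : (b - |x|) / (b - a) ≤ 0 := div_nonpos_of_nonpos_of_nonneg (by linarith) (by linarith)
  rw [trapezoid, min_eq_right (by linarith), max_eq_left this]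

theorem trapezoid_eq_div {a b x : ℝ} (hab : a < b) (h1 : a ≤ |x|) (h2 : |x| ≤ b) :
    trapezoid a b x = (b - |x|) / (b - a) := by
  have e1 : (b - |x|) / (b - a) ≤ 1 := by
    rw [div_le_one (by linarith)]
    linarith
  have e2 : 0 ≤ (b - |x|) / (b - a) := div_nonneg (by linarith) (by linarith)
  rw [trapezoid, min_eq_right e1, max_eq_right e2]

theorem trapezoid_lipschitz {a b : ℝ} (hab : a < b) (x y : ℝ) :
    |trapezoid a b x - trapezoid a b y| ≤ (1 / (b - a)) * |x - y| := by
  have hba : 0 < b - a := by linarith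
  calc |trapezoid a b x - trapezoid a b y|
      ≤ |(b - |x|) / (b - a) - (b - |y|) / (b - a)| := by
        unfold trapezoid
        refine (abs_max_sub_max_le_max _ _ _ _).trans ?_
        rw [sub_self, abs_zero]
        refine max_le (abs_nonneg _) ((abs_min_sub_min_le_max _ _ _ _).trans ?_)
        rw [sub_self, abs_zero]
        exact max_le (abs_nonneg _) le_rfl
    _ = (1 / (b - a)) * |(|y| - |x|)| := by
        rw [show (b - |x|) / (b - a) - (b - |y|) / (b - a) = (1 / (b - a)) * (|y| - |x|) by ring,
          abs_mul, abs_of_pos (by positivity : 0 < 1 / (b - a))]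
    _ ≤ (1 / (b - a)) * |x - y| := by
        rw [abs_sub_comm x y]
        exact mul_le_mul_of_nonneg_left (abs_abs_sub_abs_le y x) (by positivity)

theorem measurable_trapezoid (a b : ℝ) : Measurable (trapezoid a b) := by
  unfold trapezoid
  exact Continuous.measurable (by fun_prop)

theorem trapezoid_hasDerivAt {a b : ℝ} (ha : 0 ≤ a) (hab : a < b) :
    ∀ᵐ x : ℝ, HasDerivAt (trapezoid a b)
      (if a < |x| ∧ |x| < b then -(|x| / x) / (b - a) else 0) x := by
  filter_upwards [ae_ne_volume a, ae_ne_volume (-a), ae_ne_volume b, ae_ne_volume (-b)] with x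
    h1 h2 h3 h4
  have hxa : |x| ≠ a := fun h => by rcases (abs_eq ha).1 h with h | h <;> contradiction
  have hxb : |x| ≠ b := fun h => by
    rcases (abs_eq (ha.trans hab.le)).1 h with h | h <;> contradiction
  have hc := continuous_abs.tendsto x
  rcases lt_or_gt_of_ne hxa with h | h
  · rw [if_neg (fun h' => absurd h'.1 h.le.not_gt)]
    refine (hasDerivAt_const x (1 : ℝ)).congr_of_eventuallyEq ?_
    filter_upwards [hc.eventually (gt_mem_nhds h)] with y hy
    exact trapezoid_eq_one hab (le_of_lt hy)
  rcases lt_or_gt_of_ne hxb with h' | h'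
  · rw [if_pos ⟨h, h'⟩]
    have hx0 : x ≠ 0 := by
      rintro rfl
      simp at h
      linarith
    have hd : HasDerivAt (fun y : ℝ => (b - |y|) / (b - a)) (-(|x| / x) / (b - a)) x := by
      have h5 := ((hasDerivAt_abs hx0).const_sub b).div_const (b - a)
      have h7 : |x| / x = (SignType.sign x : ℝ) := by
        rcases lt_or_gt_of_ne hx0 with h6 | h6
        · rw [abs_of_neg h6, sign_neg h6]
          field_simp
          simp
        · rw [abs_of_pos h6, sign_pos h6]
          field_simp
          simp
      rw [h7]
      exact h5
    refine hd.congr_of_eventuallyEq ?_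
    filter_upwards [hc.eventually (gt_mem_nhds h'), hc.eventually (lt_mem_nhds h)] with y hy hy'
    exact trapezoid_eq_div hab (le_of_lt hy') (le_of_lt hy)
  · rw [if_neg (fun h'' => absurd h''.2 h'.le.not_gt)]
    refine (hasDerivAt_const x (0 : ℝ)).congr_of_eventuallyEq ?_
    filter_upwards [hc.eventually (lt_mem_nhds h')] with y hy
    exact trapezoid_eq_zero hab (le_of_lt hy)

/-! ### Collision measure and the mass of annuli -/

/-- The collision measure `|x - y|^γ m(dx) m(dy)`. -/
noncomputable def collisionMeasure (γ : ℝ) (m : Measure ℝ) : Measure (ℝ × ℝ) :=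
  (m.prod m).withDensity fun p => ENNReal.ofReal (|p.1 - p.2| ^ γ)

theorem integral_collisionMeasure (γ : ℝ) (m : Measure ℝ) (f : ℝ × ℝ → ℝ) :
    ∫ p, f p ∂(collisionMeasure γ m) = ∫ p, f p * |p.1 - p.2| ^ γ ∂(m.prod m) := by
  rw [collisionMeasure, integral_withDensity_eq_integral_toReal_smul
    (measurable_abs_sub_rpow γ).ennreal_ofReal
    (Eventually.of_forall fun p => ENNReal.ofReal_lt_top)]
  refine integral_congr_ae (Eventually.of_forall fun p => ?_)
  simp only [smul_eq_mul]
  rw [ENNReal.toReal_ofReal (by positivity), mul_comm]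

/-- The mass `q(r)` which the gain operator produces in `[-r, r]`. -/
noncomputable def gainMass (γ : ℝ) (m : Measure ℝ) (r : ℝ) : ℝ :=
  (collisionMeasure γ m).real {p | |p.1 + p.2| ≤ 2 * r}

theorem integral_indicator_const_one {α : Type*} [MeasurableSpace α] {μ : Measure α} {A : Set α}
    (hA : MeasurableSet A) : ∫ p, A.indicator (fun _ => (1 : ℝ)) p ∂μ = μ.real A := by
  simpa using integral_indicator_const (μ := μ) (1 : ℝ) hA

theorem measurableSet_gain (r : ℝ) : MeasurableSet {p : ℝ × ℝ | |p.1 + p.2| ≤ 2 * r} :=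
  (isClosed_le (by fun_prop) continuous_const).measurableSet

theorem gainMass_nonneg (γ : ℝ) (m : Measure ℝ) (r : ℝ) : 0 ≤ gainMass γ m r :=
  measureReal_nonneg

namespace SteadyMeasure

variable {γ : ℝ} {m : Measure ℝ}

theorem integrable_kernel (h : SteadyMeasure γ m) (h0 : 0 ≤ γ) (h1 : γ < 1 / 2) :
    Integrable (fun p : ℝ × ℝ => |p.1 - p.2| ^ γ) (m.prod m) := by
  simpa using h.integrable_sqrt_pow_mul_kernel h0 h1 (i := 0) (j := 0) (by norm_num)
    (by norm_num)

theorem isFiniteMeasure_collision (h : SteadyMeasure γ m) (h0 : 0 ≤ γ) (h1 : γ < 1 / 2) :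
    IsFiniteMeasure (collisionMeasure γ m) := by
  refine ⟨?_⟩
  rw [collisionMeasure, withDensity_apply _ MeasurableSet.univ, Measure.restrict_univ]
  exact (h.integrable_kernel h0 h1).lintegral_lt_top

theorem collision_univ_le (h : SteadyMeasure γ m) (h0 : 0 ≤ γ) (h1 : γ < 1 / 2) :
    (collisionMeasure γ m).real univ ≤ 2 + 2 * ∫ x : ℝ, x ^ 2 ∂m := by
  have hp := h.prob
  have hf := h.isFiniteMeasure_collision h0 h1
  have e := integral_collisionMeasure γ m fun _ => 1
  simp only [integral_const, smul_eq_mul, mul_one, one_mul] at e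
  rw [e]
  have : ∫ p : ℝ × ℝ, |p.1 - p.2| ^ γ ∂(m.prod m) ≤
      ∫ p : ℝ × ℝ, (2 + (p.1 - p.2) ^ 2) ∂(m.prod m) := by
    refine integral_mono (h.integrable_kernel h0 h1)
      ((integrable_const 2).add h.integrable_sub_sq) fun p => ?_
    have := abs_rpow_le_one_add (abs_nonneg (p.1 - p.2)) h0 (by linarith)
    have h3 := sq_abs (p.1 - p.2)
    simp only
    nlinarith [sq_nonneg (|p.1 - p.2| - 1)]
  refine this.trans ?_
  rw [integral_add (integrable_const 2) h.integrable_sub_sq, h.integral_sub_sq]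
  simp

theorem gainMass_le (h : SteadyMeasure γ m) (h0 : 0 ≤ γ) (h1 : γ < 1 / 2) (r : ℝ) :
    gainMass γ m r ≤ 2 + 2 * ∫ x : ℝ, x ^ 2 ∂m := by
  have hf := h.isFiniteMeasure_collision h0 h1
  exact (measureReal_mono (subset_univ _)).trans (h.collision_univ_le h0 h1)

theorem gainMass_mono (h : SteadyMeasure γ m) (h0 : 0 ≤ γ) (h1 : γ < 1 / 2) {r s : ℝ}
    (hrs : r ≤ s) : gainMass γ m r ≤ gainMass γ m s := by
  have hf := h.isFiniteMeasure_collision h0 h1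
  refine measureReal_mono fun p hp => ?_
  simp only [mem_ofPred_eq] at hp ⊢
  linarith

/-- The steady equation tested against trapezoids. -/
theorem trapezoid_identity (h : SteadyMeasure γ m) {a b : ℝ} (ha : 0 ≤ a) (hab : a < b) :
    ∫ x in {x : ℝ | a < |x| ∧ |x| < b}, |x| ∂m = 2 * (b - a) *
      ∫ p, collisionDiff (trapezoid a b) p.1 p.2 ∂(collisionMeasure γ m) := by
  have hw := h.weak (trapezoid a b) _ ⟨1, fun x => by
    rw [abs_of_nonneg (trapezoid_nonneg _ _ _)]; exact trapezoid_le_one _ _ _⟩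
    ⟨_, trapezoid_lipschitz hab⟩ (trapezoid_hasDerivAt ha hab)
  rw [integral_collisionMeasure γ m fun p => collisionDiff (trapezoid a b) p.1 p.2]
  have hs : MeasurableSet {x : ℝ | a < |x| ∧ |x| < b} :=
    (measurableSet_lt measurable_const measurable_norm).inter
      (measurableSet_lt measurable_norm measurable_const)
  have e : ∀ x : ℝ, x * (if a < |x| ∧ |x| < b then -(|x| / x) / (b - a) else 0) =
      (-1 / (b - a)) * indicator {x : ℝ | a < |x| ∧ |x| < b} (fun x => |x|) x := by
    intro x
    by_cases hx : a < |x| ∧ |x| < b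
    · have hx0 : x ≠ 0 := by
        rintro rfl
        simp at hx
        linarith [hx.1]
      rw [if_pos hx, indicator_of_mem (by exact hx)]
      field_simp
    · rw [if_neg hx, indicator_of_notMem (by exact hx)]
      simp
  simp only [e] at hw
  rw [integral_const_mul, integral_indicator hs] at hw
  have hba : b - a ≠ 0 := by linarith
  field_simp at hw
  linarith

theorem integrable_trapezoid_collision (h : SteadyMeasure γ m) (h0 : 0 ≤ γ) (h1 : γ < 1 / 2)
    (a b : ℝ) :
    Integrable (fun p : ℝ × ℝ => collisionDiff (trapezoid a b) p.1 p.2)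
      (collisionMeasure γ m) := by
  have hf := h.isFiniteMeasure_collision h0 h1
  refine Integrable.of_bound (measurable_collisionDiff
    (measurable_trapezoid a b)).aestronglyMeasurable 4 (Eventually.of_forall fun p => ?_)
  unfold collisionDiff
  have n := trapezoid_nonneg a b
  have l := trapezoid_le_one a b
  rw [Real.norm_eq_abs, abs_le]
  constructor <;> linarith [n p.1, n p.2, n ((p.1 + p.2) / 2), l p.1, l p.2, l ((p.1 + p.2) / 2)]

theorem measure_annulus_mul_le (h : SteadyMeasure γ m) (a b : ℝ) :
    a * m.real {x : ℝ | a < |x| ∧ |x| < b} ≤ ∫ x in {x : ℝ | a < |x| ∧ |x| < b}, |x| ∂m := by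
  have := h.prob
  have hs : MeasurableSet {x : ℝ | a < |x| ∧ |x| < b} :=
    (measurableSet_lt measurable_const measurable_norm).inter
      (measurableSet_lt measurable_norm measurable_const)
  have := setIntegral_mono_on (f := fun _ : ℝ => a) (g := fun x => |x|) (μ := m)
    (integrable_const a).integrableOn h.integrable_abs.integrableOn hs fun x hx => hx.1.le
  simpa [mul_comm] using this

/-- Discard the loss: the trapezoid difference is at most 2, and is positive only if the midpoint
lies in [-b, b]. -/
theorem annulus_le_gainMass (h : SteadyMeasure γ m) (h0 : 0 ≤ γ) (h1 : γ < 1 / 2) {a b : ℝ}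
    (ha : 0 ≤ a) (hab : a < b) :
    a * m.real {x : ℝ | a < |x| ∧ |x| < b} ≤ 4 * (b - a) * gainMass γ m b := by
  have hf := h.isFiniteMeasure_collision h0 h1
  refine (h.measure_annulus_mul_le a b).trans ?_
  rw [h.trapezoid_identity ha hab]
  have : ∫ p, collisionDiff (trapezoid a b) p.1 p.2 ∂(collisionMeasure γ m) ≤
      2 * gainMass γ m b := by
    rw [gainMass, ← integral_indicator_const_one (measurableSet_gain b), ← integral_const_mul]
    refine integral_mono (h.integrable_trapezoid_collision h0 h1 a b)
      (((integrable_const (1 : ℝ)).indicator (measurableSet_gain b)).const_mul 2) fun p => ?_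
    unfold collisionDiff
    have n1 := trapezoid_nonneg a b p.1
    have n2 := trapezoid_nonneg a b p.2
    have l := trapezoid_le_one a b ((p.1 + p.2) / 2)
    by_cases hp : |p.1 + p.2| ≤ 2 * b
    · rw [indicator_of_mem (by exact hp)]
      linarith
    · rw [indicator_of_notMem (by exact hp)]
      have : trapezoid a b ((p.1 + p.2) / 2) = 0 := by
        refine trapezoid_eq_zero hab ?_
        rw [abs_div, abs_two]
        linarith
      rw [this]
      linarith
  have hba : 0 < b - a := by linarith
  calc _ ≤ 2 * (b - a) * (2 * gainMass γ m b) := by gcongr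
    _ = _ := by ring

theorem measurableSet_fst_ge (a : ℝ) : MeasurableSet {p : ℝ × ℝ | a ≤ |p.1|} :=
  (isClosed_le continuous_const (by fun_prop)).measurableSet

theorem measurableSet_snd_ge (a : ℝ) : MeasurableSet {p : ℝ × ℝ | a ≤ |p.2|} :=
  (isClosed_le continuous_const (by fun_prop)).measurableSet

/-- Bound the gain by 2: with θ the trapezoid, the difference is at most (1-θ(x)) + (1-θ(y)), which
vanishes unless |x| ≥ a or |y| ≥ a. -/
theorem annulus_le_tail (h : SteadyMeasure γ m) (h0 : 0 ≤ γ) (h1 : γ < 1 / 2) {a b : ℝ}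
    (ha : 0 ≤ a) (hab : a < b) :
    a * m.real {x : ℝ | a < |x| ∧ |x| < b} ≤ 2 * (b - a) *
      ((collisionMeasure γ m).real {p | a ≤ |p.1|} +
        (collisionMeasure γ m).real {p | a ≤ |p.2|}) := by
  have hf := h.isFiniteMeasure_collision h0 h1
  refine (h.measure_annulus_mul_le a b).trans ?_
  rw [h.trapezoid_identity ha hab]
  have i1 := (integrable_const (μ := collisionMeasure γ m) (1 : ℝ)).indicator
    (measurableSet_fst_ge a)
  have i2 := (integrable_const (μ := collisionMeasure γ m) (1 : ℝ)).indicator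
    (measurableSet_snd_ge a)
  have hba : 0 < b - a := by linarith
  gcongr
  rw [← integral_indicator_const_one (measurableSet_fst_ge a),
    ← integral_indicator_const_one (measurableSet_snd_ge a), ← integral_add i1 i2]
  refine integral_mono (h.integrable_trapezoid_collision h0 h1 a b) (i1.add i2) fun p => ?_
  unfold collisionDiff
  have key : ∀ x : ℝ, 1 - trapezoid a b x ≤ indicator {x : ℝ | a ≤ |x|} (fun _ => 1) x := by
    intro x
    by_cases hx : a ≤ |x|
    · rw [indicator_of_mem (by exact hx)]
      simpa using trapezoid_nonneg a b x
    · rw [indicator_of_notMem (by exact hx), trapezoid_eq_one hab (le_of_not_ge hx)]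
      simp
  have k1 := key p.1
  have k2 := key p.2
  have l := trapezoid_le_one a b ((p.1 + p.2) / 2)
  have e1 : indicator {p : ℝ × ℝ | a ≤ |p.1|} (fun _ => (1 : ℝ)) p =
    indicator {x : ℝ | a ≤ |x|} (fun _ => 1) p.1 := rfl
  have e2 : indicator {p : ℝ × ℝ | a ≤ |p.2|} (fun _ => (1 : ℝ)) p =
    indicator {x : ℝ | a ≤ |x|} (fun _ => 1) p.2 := rfl
  change _ ≤ indicator {p : ℝ × ℝ | a ≤ |p.1|} (fun _ => (1 : ℝ)) p +
    indicator {p : ℝ × ℝ | a ≤ |p.2|} (fun _ => (1 : ℝ)) p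
  rw [e1, e2]
  linarith

/-- The mass in a small ball, paired with mass away from the origin, is controlled by the gain of
those pairs which do not both lie in the ball. -/
theorem loss_le_gain (h : SteadyMeasure γ m) (h0 : 0 ≤ γ) (h1 : γ < 1 / 2) {r ρ : ℝ}
    (hr : 0 < r) (hρ : 5 * r ≤ ρ) :
    (collisionMeasure γ m).real {p | |p.1| ≤ r ∧ ρ ≤ |p.2|} ≤
      2 * (collisionMeasure γ m).real {p | |p.1 + p.2| ≤ 2 * (2 * r) ∧ (r < |p.1| ∨ r < |p.2|)} := by
  have hf := h.isFiniteMeasure_collision h0 h1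
  set A : Set (ℝ × ℝ) := {p | |p.1| ≤ r ∧ ρ ≤ |p.2|} with hA
  set B : Set (ℝ × ℝ) := {p | |p.1 + p.2| ≤ 2 * (2 * r) ∧ (r < |p.1| ∨ r < |p.2|)} with hB
  have mA : MeasurableSet A := by
    exact (isClosed_le (continuous_abs.comp continuous_fst) continuous_const).measurableSet.inter
      (measurableSet_snd_ge ρ)
  have mB : MeasurableSet B := by
    exact (measurableSet_gain _).inter
      ((isOpen_lt continuous_const (continuous_abs.comp continuous_fst)).measurableSet.union
        (isOpen_lt continuous_const (continuous_abs.comp continuous_snd)).measurableSet)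
  have hr2 : r < 2 * r := by linarith
  have hid := h.trapezoid_identity hr.le hr2
  have hnn : 0 ≤ ∫ x in {x : ℝ | r < |x| ∧ |x| < 2 * r}, |x| ∂m :=
    integral_nonneg fun x => abs_nonneg x
  have hpos : 0 ≤ ∫ p, collisionDiff (trapezoid r (2 * r)) p.1 p.2 ∂(collisionMeasure γ m) := by
    rw [hid] at hnn
    exact nonneg_of_mul_nonneg_right hnn (by linarith)
  have i1 := (integrable_const (μ := collisionMeasure γ m) (1 : ℝ)).indicator mA
  have i2 := ((integrable_const (μ := collisionMeasure γ m) (1 : ℝ)).indicator mB).const_mul 2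
  -- The total is nonnegative, so loss is paid for by gain. On A the midpoint is beyond 2r (as ρ ≥
  -- 5r) and the difference is ≤ -1; pairs inside the r-ball contribute at most 0; only pairs in B
  -- can be positive.
  have hle : ∫ p, collisionDiff (trapezoid r (2 * r)) p.1 p.2 ∂(collisionMeasure γ m) ≤
      2 * (collisionMeasure γ m).real B - (collisionMeasure γ m).real A := by
    rw [← integral_indicator_const_one mA, ← integral_indicator_const_one mB, ← integral_const_mul,
      ← integral_sub i2 i1]
    refine integral_mono (h.integrable_trapezoid_collision h0 h1 _ _) (i2.sub i1) fun p => ?_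
    change collisionDiff (trapezoid r (2 * r)) p.1 p.2 ≤
      2 * indicator B (fun _ => (1 : ℝ)) p - indicator A (fun _ => (1 : ℝ)) p
    unfold collisionDiff
    have n1 := trapezoid_nonneg r (2 * r) p.1
    have n2 := trapezoid_nonneg r (2 * r) p.2
    have l := trapezoid_le_one r (2 * r) ((p.1 + p.2) / 2)
    have hz : 2 * (2 * r) ≤ |p.1 + p.2| → trapezoid r (2 * r) ((p.1 + p.2) / 2) = 0 := by
      intro hp
      refine trapezoid_eq_zero hr2 ?_
      rw [abs_div, abs_two]
      linarith
    by_cases pA : p ∈ A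
    · have pB0 : 0 ≤ indicator B (fun _ => (1 : ℝ)) p :=
        indicator_nonneg (fun _ _ => zero_le_one) p
      have t1 : trapezoid r (2 * r) p.1 = 1 := trapezoid_eq_one hr2 pA.1
      have t2 : 2 * (2 * r) ≤ |p.1 + p.2| := by
        have := abs_sub_abs_le_abs_add p.2 p.1
        rw [add_comm p.2 p.1] at this
        have := pA.1
        have := pA.2
        linarith
      rw [indicator_of_mem pA, hz t2, t1]
      linarith
    · rw [indicator_of_notMem pA]
      by_cases pB : p ∈ B
      · rw [indicator_of_mem pB]
        linarith
      · rw [indicator_of_notMem pB]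
        by_cases hp : |p.1 + p.2| ≤ 2 * (2 * r)
        · have h3 : ¬ (r < |p.1| ∨ r < |p.2|) := fun h' => pB ⟨hp, h'⟩
          push Not at h3
          rw [trapezoid_eq_one hr2 h3.1, trapezoid_eq_one hr2 h3.2]
          linarith
        · rw [hz (le_of_not_ge hp)]
          linarith
  linarith

theorem collision_le_prod (h : SteadyMeasure γ m) (h0 : 0 ≤ γ) {A : Set (ℝ × ℝ)}
    (hA : MeasurableSet A) (hA1 : ∀ p ∈ A, |p.1 - p.2| ≤ 1) :
    (collisionMeasure γ m).real A ≤ (m.prod m).real A := by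
  have := h.prob
  refine ENNReal.toReal_mono (measure_ne_top _ _) ?_
  rw [collisionMeasure, withDensity_apply _ hA]
  calc _ ≤ ∫⁻ _ in A, 1 ∂(m.prod m) := by
        refine setLIntegral_mono measurable_const fun p hp => ?_
        rw [ENNReal.ofReal_le_one]
        exact Real.rpow_le_one (abs_nonneg _) (hA1 p hp) h0
    _ = _ := by simp

theorem mul_prod_le_collision (h : SteadyMeasure γ m) (h0 : 0 ≤ γ) (h1 : γ < 1 / 2)
    {A : Set (ℝ × ℝ)} (hA : MeasurableSet A) {c : ℝ} (hc : 0 < c) (hc1 : c ≤ 1)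
    (hA1 : ∀ p ∈ A, c ≤ |p.1 - p.2|) :
    c * (m.prod m).real A ≤ (collisionMeasure γ m).real A := by
  have := h.prob
  have hf := h.isFiniteMeasure_collision h0 h1
  have hle : ENNReal.ofReal c * (m.prod m) A ≤ collisionMeasure γ m A := by
    rw [collisionMeasure, withDensity_apply _ hA, ← setLIntegral_const]
    refine setLIntegral_mono (measurable_abs_sub_rpow γ).ennreal_ofReal fun p hp => ?_
    refine ENNReal.ofReal_le_ofReal ?_
    calc c = c ^ (1 : ℝ) := (Real.rpow_one c).symm
      _ ≤ c ^ γ := Real.rpow_le_rpow_of_exponent_ge hc hc1 (by linarith)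
      _ ≤ _ := Real.rpow_le_rpow hc.le (hA1 p hp) h0
  have := ENNReal.toReal_mono (measure_ne_top _ _) hle
  rwa [ENNReal.toReal_mul, ENNReal.toReal_ofReal hc.le] at this

/-- An interval of half-width 2r about -y sits in the annulus |y| ± 3r, whose mass is at most
24r·q(2|y|) over its inner radius, and that radius is at least |y|/4. -/
theorem measure_translate_le (h : SteadyMeasure γ m) (h0 : 0 ≤ γ) (h1 : γ < 1 / 2) {r y : ℝ}
    (hr : 0 < r) (hy : 4 * r < |y|) :
    m.real {x | |x + y| ≤ 2 * r} ≤ 96 * r * gainMass γ m (2 * |y|) / |y| := by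
  have := h.prob
  have hy0 : 0 < |y| := by linarith
  have hsub : {x | |x + y| ≤ 2 * r} ⊆ {x : ℝ | |y| - 3 * r < |x| ∧ |x| < |y| + 3 * r} := by
    intro x hx
    simp only [mem_ofPred_eq] at hx ⊢
    have a1 := abs_sub_abs_le_abs_add x y
    have a2 := abs_sub_abs_le_abs_add y x
    rw [add_comm y x] at a2
    constructor <;> linarith
  have hle := h.annulus_le_gainMass h0 h1 (a := |y| - 3 * r) (b := |y| + 3 * r) (by linarith)
    (by linarith)
  have hmono := measureReal_mono (μ := m) hsub
  have hg := h.gainMass_mono h0 h1 (show |y| + 3 * r ≤ 2 * |y| by linarith)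
  rw [le_div_iff₀ hy0]
  have n := measureReal_nonneg (μ := m) (s := {x : ℝ | |y| - 3 * r < |x| ∧ |x| < |y| + 3 * r})
  have b1 : |y| / 4 * m.real {x : ℝ | |y| - 3 * r < |x| ∧ |x| < |y| + 3 * r} ≤
      (|y| - 3 * r) * m.real {x : ℝ | |y| - 3 * r < |x| ∧ |x| < |y| + 3 * r} :=
    mul_le_mul_of_nonneg_right (by linarith) n
  have b2 : 4 * (|y| + 3 * r - (|y| - 3 * r)) * gainMass γ m (|y| + 3 * r) ≤
      24 * r * gainMass γ m (2 * |y|) := by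
    rw [show 4 * (|y| + 3 * r - (|y| - 3 * r)) = 24 * r by ring]
    gcongr
  have b3 := mul_le_mul_of_nonneg_right hmono hy0.le
  linarith

/-- Fubini in y: the partner x must lie within 2r of -y, where the kernel is at most 1 + 3|y|, so D
bounds each slice. -/
theorem collision_far_le (h : SteadyMeasure γ m) (h0 : 0 ≤ γ) (h1 : γ < 1 / 2) {r D : ℝ}
    (hr : 0 < r) (hD : 0 ≤ D) {Y : Set ℝ} (hY : MeasurableSet Y)
    (hfar : ∀ y ∈ Y, 4 * r < |y| ∧ (1 + 3 * |y|) * (96 * r * gainMass γ m (2 * |y|) / |y|) ≤ D) :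
    (collisionMeasure γ m).real {p | |p.1 + p.2| ≤ 2 * r ∧ p.2 ∈ Y} ≤ D * m.real Y := by
  have := h.prob
  set A : Set (ℝ × ℝ) := {p | |p.1 + p.2| ≤ 2 * r ∧ p.2 ∈ Y} with hA
  have mA : MeasurableSet A := (measurableSet_gain r).inter (measurable_snd hY)
  have hle : collisionMeasure γ m A ≤ ENNReal.ofReal D * m Y := by
    rw [collisionMeasure, withDensity_apply _ mA]
    calc _ ≤ ∫⁻ p in A, ENNReal.ofReal (1 + 3 * |p.2|) ∂(m.prod m) := by
          refine setLIntegral_mono (by fun_prop) fun p hp => ENNReal.ofReal_le_ofReal ?_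
          have a1 := abs_rpow_le_one_add (abs_nonneg (p.1 - p.2)) h0 (by linarith)
          have a2 := abs_sub_abs_le_abs_add p.1 p.2
          have a3 := abs_sub p.1 p.2
          have a4 := hp.1
          have a5 := (hfar p.2 hp.2).1
          linarith
      _ = ∫⁻ p, A.indicator (fun p => ENNReal.ofReal (1 + 3 * |p.2|)) p ∂(m.prod m) :=
          (lintegral_indicator mA _).symm
      _ = ∫⁻ y, ∫⁻ x, A.indicator (fun p => ENNReal.ofReal (1 + 3 * |p.2|)) (x, y) ∂m ∂m := by
          refine lintegral_prod_symm _ (Measurable.aemeasurable ?_)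
          exact Measurable.indicator (by fun_prop) mA
      _ ≤ ∫⁻ y, Y.indicator (fun _ => ENNReal.ofReal D) y ∂m := by
          refine lintegral_mono fun y => ?_
          by_cases hy : y ∈ Y
          · have e : ∀ x, A.indicator (fun p => ENNReal.ofReal (1 + 3 * |p.2|)) (x, y) =
                {x | |x + y| ≤ 2 * r}.indicator (fun _ => ENNReal.ofReal (1 + 3 * |y|)) x := by
              intro x
              by_cases hx : |x + y| ≤ 2 * r
              · rw [indicator_of_mem (by exact ⟨hx, hy⟩), indicator_of_mem (by exact hx)]
              · rw [indicator_of_notMem (fun h' => hx h'.1), indicator_of_notMem (by exact hx)]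
            have ms : MeasurableSet {x | |x + y| ≤ 2 * r} :=
              (isClosed_le (by fun_prop) continuous_const).measurableSet
            simp only [e]
            rw [lintegral_indicator ms, setLIntegral_const, indicator_of_mem hy,
              ← ENNReal.ofReal_toReal (measure_ne_top m _), ← ENNReal.ofReal_mul (by positivity)]
            refine ENNReal.ofReal_le_ofReal (le_trans ?_ (hfar y hy).2)
            gcongr
            exact h.measure_translate_le h0 h1 hr (hfar y hy).1
          · have e : ∀ x, A.indicator (fun p => ENNReal.ofReal (1 + 3 * |p.2|)) (x, y) = 0 :=
              fun x => indicator_of_notMem (fun h' => hy h'.2) _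
            simp [e]
      _ = _ := by rw [lintegral_indicator hY, setLIntegral_const]
  have := ENNReal.toReal_mono (ENNReal.mul_ne_top ENNReal.ofReal_ne_top (measure_ne_top _ _)) hle
  rwa [ENNReal.toReal_mul, ENNReal.toReal_ofReal hD] at this

end SteadyMeasure

/-! ### Absence of concentration at the origin -/

theorem measurableSet_abs_le (r : ℝ) : MeasurableSet {x : ℝ | |x| ≤ r} :=
  measurableSet_le measurable_norm measurable_const

theorem measurableSet_lt_abs (r : ℝ) : MeasurableSet {x : ℝ | r < |x|} :=
  measurableSet_lt measurable_const measurable_norm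

theorem measurableSet_le_abs (r : ℝ) : MeasurableSet {x : ℝ | r ≤ |x|} :=
  measurableSet_le measurable_const measurable_norm

namespace SteadyMeasure

variable {γ : ℝ} {m : Measure ℝ}

/-- Energy splits into |x| < ρ, a bounded region √|x| ≤ l, and a remainder controlled by the 5/2
moment; a lower bound on the energy thus forces mass beyond ρ. -/
theorem measure_away_ge (h : SteadyMeasure γ m) {c C ρ l : ℝ} (hl : 0 < l)
    (hc : c ≤ ∫ x : ℝ, x ^ 2 ∂m) (hC : ∫ x : ℝ, √|x| ^ 5 ∂m ≤ C) :
    c ≤ ρ ^ 2 + l ^ 4 * m.real {x : ℝ | ρ ≤ |x|} + C / l := by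
  have := h.prob
  have i5 := h.integrable_sqrt_pow (k := 5) le_rfl
  have i1 := (integrable_const (μ := m) (1 : ℝ)).indicator (measurableSet_le_abs ρ)
  have i2 : Integrable (fun x => ρ ^ 2 + l ^ 4 * {x : ℝ | ρ ≤ |x|}.indicator (fun _ => 1) x) m :=
    (integrable_const _).add (i1.const_mul _)
  have hle : ∫ x : ℝ, x ^ 2 ∂m ≤ ∫ x : ℝ, ((ρ ^ 2 + l ^ 4 *
      {x : ℝ | ρ ≤ |x|}.indicator (fun _ => 1) x) + √|x| ^ 5 / l) ∂m := by
    refine integral_mono h.integrable_sq (i2.add (i5.div_const l)) fun x => ?_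
    have n5 : 0 ≤ √|x| ^ 5 / l := by positivity
    simp only
    by_cases hx : ρ ≤ |x|
    · rw [indicator_of_mem (by exact hx), ← sqrt_abs_pow_four]
      rcases le_total √|x| l with h3 | h3
      · have : √|x| ^ 4 ≤ l ^ 4 := by gcongr
        nlinarith [sq_nonneg ρ]
      · have : √|x| ^ 4 ≤ √|x| ^ 5 / l := by
          rw [le_div_iff₀ hl]
          calc √|x| ^ 4 * l ≤ √|x| ^ 4 * √|x| := by gcongr
            _ = √|x| ^ 5 := by ring
        nlinarith [sq_nonneg ρ, pow_pos hl 4]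
    · rw [indicator_of_notMem (by exact hx), ← sq_abs x]
      have : |x| ^ 2 ≤ ρ ^ 2 := pow_le_pow_left₀ (abs_nonneg x) (le_of_not_ge hx) 2
      linarith
  rw [integral_add i2 (i5.div_const l), integral_add (integrable_const _) (i1.const_mul _),
    integral_const_mul, integral_div, integral_indicator_const_one (measurableSet_le_abs ρ)] at hle
  simp at hle
  have : (∫ x : ℝ, √|x| ^ 5 ∂m) / l ≤ C / l := by gcongr
  linarith

theorem mul_ball_le_loss (h : SteadyMeasure γ m) (h0 : 0 ≤ γ) (h1 : γ < 1 / 2) {ρ κ r : ℝ}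
    (hρ : 0 < ρ) (hρ1 : ρ ≤ 1) (hκ : κ ≤ m.real {x : ℝ | ρ ≤ |x|}) (hr : 5 * r ≤ ρ) :
    ρ / 2 * κ * m.real {x : ℝ | |x| ≤ r} ≤
      (collisionMeasure γ m).real {p | |p.1| ≤ r ∧ ρ ≤ |p.2|} := by
  have := h.prob
  have hA : {p : ℝ × ℝ | |p.1| ≤ r ∧ ρ ≤ |p.2|} = {x : ℝ | |x| ≤ r} ×ˢ {x : ℝ | ρ ≤ |x|} := rfl
  have hle := h.mul_prod_le_collision h0 h1 (A := {p : ℝ × ℝ | |p.1| ≤ r ∧ ρ ≤ |p.2|})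
    (by rw [hA]; exact (measurableSet_abs_le r).prod (measurableSet_le_abs ρ))
    (c := ρ / 2) (by linarith) (by linarith) (fun p hp => by
      have a1 := abs_sub_abs_le_abs_sub p.2 p.1
      rw [abs_sub_comm] at a1
      have a2 := hp.1
      have a3 := hp.2
      linarith)
  refine le_trans ?_ hle
  rw [hA, measureReal_prod_prod]
  have n := measureReal_nonneg (μ := m) (s := {x : ℝ | |x| ≤ r})
  have := mul_le_mul_of_nonneg_left hκ n
  nlinarith

theorem mul_ball_le_gainMass (h : SteadyMeasure γ m) (h0 : 0 ≤ γ) (h1 : γ < 1 / 2) {ρ κ r : ℝ}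
    (hρ : 0 < ρ) (hρ1 : ρ ≤ 1) (hκ : κ ≤ m.real {x : ℝ | ρ ≤ |x|}) (hr0 : 0 < r)
    (hr : 5 * r ≤ ρ) :
    ρ / 2 * κ * m.real {x : ℝ | |x| ≤ r} ≤ 2 * gainMass γ m (2 * r) := by
  have hf := h.isFiniteMeasure_collision h0 h1
  refine (h.mul_ball_le_loss h0 h1 hρ hρ1 hκ hr).trans ((h.loss_le_gain h0 h1 hr0 hr).trans ?_)
  have : (collisionMeasure γ m).real {p | |p.1 + p.2| ≤ 2 * (2 * r) ∧ (r < |p.1| ∨ r < |p.2|)} ≤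
    gainMass γ m (2 * r) := measureReal_mono fun p hp => hp.1
  linarith

theorem far_gain_le (h : SteadyMeasure γ m) (h0 : 0 ≤ γ) (h1 : γ < 1 / 2) {Q r s : ℝ}
    (hQ : ∀ t, gainMass γ m t ≤ Q) (hr : 0 < r) (hs : 4 * r ≤ s) :
    (collisionMeasure γ m).real {p | |p.1 + p.2| ≤ 2 * r ∧ p.2 ∈ {y : ℝ | s < |y|}} ≤
      96 * r * Q * (1 / s + 3) := by
  have := h.prob
  have hQ0 : 0 ≤ Q := (gainMass_nonneg γ m 0).trans (hQ 0)
  have hs0 : 0 < s := by linarith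
  have hle := h.collision_far_le h0 h1 (r := r) (D := 96 * r * Q * (1 / s + 3)) hr (by positivity)
    (measurableSet_lt_abs s) (fun y hy => ?_)
  · refine hle.trans (mul_le_of_le_one_right (by positivity) measureReal_le_one)
  · simp only [mem_ofPred_eq] at hy
    have hy0 : 0 < |y| := by linarith
    refine ⟨by linarith, ?_⟩
    calc (1 + 3 * |y|) * (96 * r * gainMass γ m (2 * |y|) / |y|)
        ≤ (1 + 3 * |y|) * (96 * r * Q / |y|) := by
          gcongr
          exact hQ _
      _ = 96 * r * Q * (1 / |y| + 3) := by field_simp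
      _ ≤ _ := by gcongr

/-- Compensating pairs either have a member far out, costing O(Q/K), or lie in the Kr-ball with a
member in the annulus r < |x| ≤ Kr. Hence mass in the ball forces mass in the next annulus. -/
theorem mul_ball_le_annulus (h : SteadyMeasure γ m) (h0 : 0 ≤ γ) (h1 : γ < 1 / 2)
    {ρ κ Q K r : ℝ} (hρ : 0 < ρ) (hρ1 : ρ ≤ 1) (hκ : κ ≤ m.real {x : ℝ | ρ ≤ |x|})
    (hQ : ∀ t, gainMass γ m t ≤ Q) (hK : 12 ≤ K) (hr0 : 0 < r) (hr : 5 * r ≤ ρ)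
    (hKr : 3 * K * r ≤ 1) :
    ρ / 2 * κ * m.real {x : ℝ | |x| ≤ r} ≤
      4 * (m.real {x : ℝ | |x| ≤ K * r} - m.real {x : ℝ | |x| ≤ r}) + 768 * Q / (K - 4) := by
  have := h.prob
  have hf := h.isFiniteMeasure_collision h0 h1
  have hQ0 : 0 ≤ Q := (gainMass_nonneg γ m 0).trans (hQ 0)
  refine (h.mul_ball_le_loss h0 h1 hρ hρ1 hκ hr).trans ((h.loss_le_gain h0 h1 hr0 hr).trans ?_)
  have hrK : r ≤ K * r := by nlinarith
  set N : Set ℝ := {x : ℝ | |x| ≤ K * r} with hN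
  set R : Set ℝ := {x : ℝ | |x| ≤ K * r} \ {x : ℝ | |x| ≤ r} with hR
  have mN : MeasurableSet N := measurableSet_abs_le _
  have mR : MeasurableSet R := mN.diff (measurableSet_abs_le _)
  have hRm : m.real R = m.real {x : ℝ | |x| ≤ K * r} - m.real {x : ℝ | |x| ≤ r} := by
    refine measureReal_sdiff (fun x hx => ?_) (measurableSet_abs_le _)
    simp only [mem_ofPred_eq] at hx ⊢
    linarith
  have hsub : {p : ℝ × ℝ | |p.1 + p.2| ≤ 2 * (2 * r) ∧ (r < |p.1| ∨ r < |p.2|)} ⊆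
      (R ×ˢ N ∪ N ×ˢ R) ∪ {p | |p.1 + p.2| ≤ 2 * (2 * r) ∧ p.2 ∈ {y : ℝ | (K - 4) * r < |y|}} := by
    rintro p ⟨hp, hp'⟩
    by_cases hy : (K - 4) * r < |p.2|
    · exact Or.inr ⟨hp, hy⟩
    left
    push Not at hy
    have a1 := abs_sub_abs_le_abs_add p.1 p.2
    have b1 : |p.1| ≤ K * r := by nlinarith
    have b2 : |p.2| ≤ K * r := by nlinarith
    rcases hp' with h3 | h3
    · exact Or.inl ⟨⟨b1, not_le.2 h3⟩, b2⟩
    · exact Or.inr ⟨b1, ⟨b2, not_le.2 h3⟩⟩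
  have hnear : ∀ {S T : Set ℝ}, MeasurableSet S → MeasurableSet T → S ⊆ N → T ⊆ N →
      (collisionMeasure γ m).real (S ×ˢ T) ≤ m.real S * m.real T := by
    intro S T mS mT hS hT
    rw [← measureReal_prod_prod]
    refine h.collision_le_prod h0 (mS.prod mT) fun p hp => ?_
    have a1 := abs_sub p.1 p.2
    have a2 : |p.1| ≤ K * r := hS hp.1
    have a3 : |p.2| ≤ K * r := hT hp.2
    nlinarith
  have hRN : R ⊆ N := sdiff_subset
  have n1 := hnear mR mN hRN subset_rfl
  have n2 := hnear mN mR subset_rfl hRN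
  have hN1 : m.real N ≤ 1 := measureReal_le_one
  have hR0 : 0 ≤ m.real R := measureReal_nonneg
  have hfar := h.far_gain_le h0 h1 hQ (r := 2 * r) (s := (K - 4) * r) (by linarith) (by nlinarith)
  have hD : 96 * (2 * r) * Q * (1 / ((K - 4) * r) + 3) ≤ 384 * Q / (K - 4) := by
    have hK4 : 0 < K - 4 := by linarith
    have e : 96 * (2 * r) * Q * (1 / ((K - 4) * r) + 3) =
        192 * Q * (1 + 3 * r * (K - 4)) / (K - 4) := by
      field_simp
      ring
    rw [e]
    refine div_le_div_of_nonneg_right ?_ hK4.le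
    have : 3 * r * (K - 4) ≤ 1 := by nlinarith
    nlinarith
  have hm := (measureReal_mono (μ := collisionMeasure γ m) hsub).trans
    ((measureReal_union_le _ _).trans (add_le_add_left (measureReal_union_le _ _) _))
  rw [← hRm]
  have e1 : m.real R * m.real N ≤ m.real R := mul_le_of_le_one_right hR0 hN1
  have e2 : m.real N * m.real R ≤ m.real R := mul_le_of_le_one_left hR0 hN1
  have e3 : 768 * Q / (K - 4) = 2 * (384 * Q / (K - 4)) := by ring
  rw [e3]
  linarith

theorem gainMass_le_ball_sq_add_far (h : SteadyMeasure γ m) (h0 : 0 ≤ γ) (h1 : γ < 1 / 2)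
    {K r : ℝ} (hr0 : 0 < r) (hKr : 2 * K * r ≤ 1) :
    gainMass γ m r ≤ m.real {x : ℝ | |x| ≤ K * r} ^ 2 +
      (collisionMeasure γ m).real
        {p | |p.1 + p.2| ≤ 2 * r ∧ p.2 ∈ {y : ℝ | (K - 2) * r < |y|}} := by
  have := h.prob
  have hf := h.isFiniteMeasure_collision h0 h1
  set N : Set ℝ := {x : ℝ | |x| ≤ K * r} with hN
  have mN : MeasurableSet N := measurableSet_abs_le _
  have hsub : {p : ℝ × ℝ | |p.1 + p.2| ≤ 2 * r} ⊆
      N ×ˢ N ∪ {p | |p.1 + p.2| ≤ 2 * r ∧ p.2 ∈ {y : ℝ | (K - 2) * r < |y|}} := by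
    intro p hp
    by_cases hy : (K - 2) * r < |p.2|
    · exact Or.inr ⟨hp, hy⟩
    left
    push Not at hy
    simp only [mem_ofPred_eq] at hp
    have a1 := abs_sub_abs_le_abs_add p.1 p.2
    have b1 : |p.1| ≤ K * r := by nlinarith
    have b2 : |p.2| ≤ K * r := by nlinarith
    exact ⟨b1, b2⟩
  have hnear : (collisionMeasure γ m).real (N ×ˢ N) ≤ m.real N ^ 2 := by
    rw [sq, ← measureReal_prod_prod]
    refine h.collision_le_prod h0 (mN.prod mN) fun p hp => ?_
    have a1 := abs_sub p.1 p.2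
    have a2 : |p.1| ≤ K * r := hp.1
    have a3 : |p.2| ≤ K * r := hp.2
    nlinarith
  exact (measureReal_mono hsub).trans ((measureReal_union_le _ _).trans
    (add_le_add_left hnear _))

/-- Steady measures do not concentrate at the origin, uniformly. -/
theorem exists_ball_le {ρ κ Q ε : ℝ} (hρ : 0 < ρ) (hρ1 : ρ ≤ 1) (hκ0 : 0 < κ) (hQ0 : 0 < Q)
    (hε : 0 < ε) : ∃ r > 0, ∀ γ : ℝ, 0 ≤ γ → γ < 1 / 2 → ∀ m : Measure ℝ, SteadyMeasure γ m →
      κ ≤ m.real {x : ℝ | ρ ≤ |x|} → (∀ t, gainMass γ m t ≤ Q) →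
      m.real {x : ℝ | |x| ≤ r} ≤ ε := by
  set c : ℝ := ρ / 2 * κ with hc
  have hc0 : 0 < c := by positivity
  set K : ℝ := 12 + 1536 * Q / (c * ε) with hK
  have hK12 : 12 ≤ K := by
    have : 0 ≤ 1536 * Q / (c * ε) := by positivity
    linarith
  have hKQ : 768 * Q / (K - 4) ≤ c * ε / 2 := by
    rw [div_le_iff₀ (by linarith)]
    have : c * ε / 2 * (K - 4) = c * ε / 2 * 8 + 768 * Q := by
      rw [hK]
      field_simp
      ring
    rw [this]
    have : 0 < c * ε / 2 * 8 := by positivity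
    linarith
  obtain ⟨N, hN⟩ := exists_nat_gt (8 / (c * ε))
  have hN0 : (0 : ℝ) < N := lt_trans (by positivity) hN
  have hN4 : 4 * (1 / (N : ℝ)) ≤ c * ε / 2 := by
    rw [div_lt_iff₀ (by positivity)] at hN
    rw [mul_one_div, div_le_iff₀ hN0]
    nlinarith
  have hK0 : 0 < K := by linarith
  set r₀ : ℝ := min (1 / (3 * K)) (ρ / 5) with hr₀
  have hr₀0 : 0 < r₀ := by positivity
  have hanti : ∀ j : ℕ, r₀ / K ^ j ≤ r₀ := fun j =>
    div_le_self hr₀0.le (one_le_pow₀ (by linarith))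
  refine ⟨r₀ / K ^ N, by positivity, fun γ h0 h1 m h hκ hQ => ?_⟩
  have := h.prob
  set f : ℕ → ℝ := fun j => m.real {x : ℝ | |x| ≤ r₀ / K ^ j} with hf
  have hsum : ∑ j ∈ Finset.range N, (f j - f (j + 1)) ≤ ∑ _j ∈ Finset.range N, 1 / (N : ℝ) := by
    rw [Finset.sum_range_sub', Finset.sum_const, Finset.card_range, nsmul_eq_mul,
      mul_one_div_cancel hN0.ne']
    have : f 0 ≤ 1 := measureReal_le_one
    have : 0 ≤ f N := measureReal_nonneg
    linarith
  -- Pigeonhole: N disjoint annuli share mass at most 1, so one has mass ≤ 1/N. N and K are chosen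
  -- so that its contribution and the far one are each at most cε/2.
  obtain ⟨j, hj, hfj⟩ := Finset.exists_le_of_sum_le
    (by rw [Finset.nonempty_range_iff]; rintro rfl; simp at hN0) hsum
  have hKr : K * (r₀ / K ^ (j + 1)) = r₀ / K ^ j := by
    rw [pow_succ]
    field_simp
  have hle := h.mul_ball_le_annulus h0 h1 hρ hρ1 hκ hQ hK12 (r := r₀ / K ^ (j + 1))
    (by positivity) (by
      have := hanti (j + 1)
      have : r₀ ≤ ρ / 5 := min_le_right _ _
      linarith) (by
      have h3 : r₀ ≤ 1 / (3 * K) := min_le_left _ _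
      have := (hanti (j + 1)).trans h3
      rw [le_div_iff₀ (by positivity)] at this
      linarith)
  rw [hKr] at hle
  have hmono : m.real {x : ℝ | |x| ≤ r₀ / K ^ N} ≤ f (j + 1) := by
    refine measureReal_mono fun x hx => ?_
    simp only [mem_ofPred_eq] at hx ⊢
    refine hx.trans ?_
    have hjN : j + 1 ≤ N := Finset.mem_range.1 hj
    gcongr
    linarith
  refine hmono.trans ?_
  have : c * f (j + 1) ≤ c * ε := by
    change c * f (j + 1) ≤ 4 * (f j - f (j + 1)) + _ at hle
    linarith
  exact le_of_mul_le_mul_left this hc0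

theorem exists_gainMass_le {ρ κ Q ε : ℝ} (hρ : 0 < ρ) (hρ1 : ρ ≤ 1) (hκ0 : 0 < κ) (hQ0 : 0 < Q)
    (hε : 0 < ε) : ∃ r > 0, ∀ γ : ℝ, 0 ≤ γ → γ < 1 / 2 → ∀ m : Measure ℝ, SteadyMeasure γ m →
      κ ≤ m.real {x : ℝ | ρ ≤ |x|} → (∀ t, gainMass γ m t ≤ Q) → gainMass γ m r ≤ ε := by
  obtain ⟨r₁, hr₁, H⟩ := exists_ball_le hρ hρ1 hκ0 hQ0 (half_pos hε)
  set K : ℝ := 6 + 384 * Q / ε with hK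
  have hK6 : 6 ≤ K := by
    have : 0 ≤ 384 * Q / ε := by positivity
    linarith
  have hK0 : 0 < K := by linarith
  set r : ℝ := min (r₁ / K) (1 / (3 * K)) with hr
  have hr0 : 0 < r := by positivity
  have hKr1 : K * r ≤ r₁ := by
    have : r ≤ r₁ / K := min_le_left _ _
    rwa [le_div_iff₀ hK0, mul_comm] at this
  have hKr3 : 3 * K * r ≤ 1 := by
    have : r ≤ 1 / (3 * K) := min_le_right _ _
    rw [le_div_iff₀ (by positivity)] at this
    linarith
  refine ⟨r, hr0, fun γ h0 h1 m h hκ hQ => ?_⟩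
  have := h.prob
  have hle := h.gainMass_le_ball_sq_add_far h0 h1 (K := K) hr0 (by nlinarith)
  have hfar := h.far_gain_le h0 h1 hQ (r := r) (s := (K - 2) * r) hr0 (by nlinarith)
  have hball : m.real {x : ℝ | |x| ≤ K * r} ≤ ε / 2 := by
    refine le_trans (measureReal_mono fun x hx => ?_) (H γ h0 h1 m h hκ hQ)
    exact le_trans hx hKr1
  have hsq : m.real {x : ℝ | |x| ≤ K * r} ^ 2 ≤ ε / 2 := by
    refine le_trans ?_ hball
    exact pow_le_of_le_one measureReal_nonneg measureReal_le_one (by norm_num)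
  have hD : 96 * r * Q * (1 / ((K - 2) * r) + 3) ≤ ε / 2 := by
    have hK2 : 0 < K - 2 := by linarith
    have e : 96 * r * Q * (1 / ((K - 2) * r) + 3) =
        96 * Q * (1 + 3 * r * (K - 2)) / (K - 2) := by
      field_simp
    rw [e, div_le_iff₀ hK2]
    have e2 : ε / 2 * (K - 2) = ε / 2 * 4 + 192 * Q := by
      rw [hK]
      field_simp
      ring
    have : 96 * Q * (1 + 3 * r * (K - 2)) ≤ 96 * Q * 2 := by
      gcongr
      nlinarith
    rw [e2]
    linarith
  linarith

/-! ### Power decay of the gain -/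

/-- The gain in small balls decays like a power, uniformly over steady measures. -/
theorem exists_gainMass_le_rpow {ρ κ Q : ℝ} (hρ : 0 < ρ) (hρ1 : ρ ≤ 1) (hκ0 : 0 < κ)
    (hQ0 : 0 < Q) : ∃ A > 0, ∀ γ : ℝ, 0 ≤ γ → γ < 1 / 2 → ∀ m : Measure ℝ, SteadyMeasure γ m →
      κ ≤ m.real {x : ℝ | ρ ≤ |x|} → (∀ t, gainMass γ m t ≤ Q) →
      ∀ r : ℝ, 0 < r → r ≤ 1 → gainMass γ m r ≤ A * r ^ (3 / 4 : ℝ) := by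
  set d : ℝ := 2 / (ρ / 2 * κ) with hd
  have hd0 : 0 < d := by positivity
  -- The two bounds make the near and the intermediate contributions each at most a quarter of A
  -- r^(3/4); A is chosen so that the far one takes the remaining half.
  set ε : ℝ := min (1 / (48 * d ^ 2)) (1 / (1536 * d)) with hεdef
  have hε : 0 < ε := by positivity
  have hε1 : 48 * d ^ 2 * ε ≤ 1 := by
    have : ε ≤ 1 / (48 * d ^ 2) := min_le_left _ _
    rw [le_div_iff₀ (by positivity)] at this
    linarith
  have hε2 : 1536 * d * ε ≤ 1 := by
    have : ε ≤ 1 / (1536 * d) := min_le_right _ _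
    rw [le_div_iff₀ (by positivity)] at this
    linarith
  obtain ⟨s₀, hs₀, H⟩ := exists_gainMass_le hρ hρ1 hκ0 hQ0 hε
  set s : ℝ := min s₀ (min (ρ / 5) (1 / 12)) with hs
  have hs0 : 0 < s := by positivity
  have hss : s ≤ s₀ := min_le_left _ _
  have hsρ : s ≤ ρ / 5 := (min_le_right _ _).trans (min_le_left _ _)
  have hs12 : s ≤ 1 / 12 := (min_le_right _ _).trans (min_le_right _ _)
  set r₁ : ℝ := s / 12 with hr₁
  have hr₁0 : 0 < r₁ := by positivity
  set R : ℝ := s / 2 with hR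
  have hR0 : 0 < R := by positivity
  set A : ℝ := Q / r₁ ^ (3 / 4 : ℝ) + 192 * Q * (1 / R + 3) with hA
  have hA0 : 0 < A := by positivity
  refine ⟨A, hA0, fun γ h0 h1 m h hκ hQ => ?_⟩
  have := h.prob
  have hf := h.isFiniteMeasure_collision h0 h1
  have hqs : gainMass γ m s ≤ ε := (h.gainMass_mono h0 h1 hss).trans (H γ h0 h1 m h hκ hQ)
  have hball : ∀ t, 0 < t → 5 * t ≤ ρ → m.real {x : ℝ | |x| ≤ t} ≤ d * gainMass γ m (2 * t) := by
    intro t ht0 ht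
    have := h.mul_ball_le_gainMass h0 h1 hρ hρ1 hκ ht0 ht
    rw [hd, div_mul_eq_mul_div, le_div_iff₀ (by positivity)]
    linarith
  -- Induction downwards in dyadic radii. The gain at r is estimated from radii 12r and 2|y| > 8r,
  -- both covered already; r₁ = s/12 and R = s/2 keep them at most s.
  have key : ∀ n : ℕ, ∀ r : ℝ, r₁ / 2 ^ n ≤ r → r ≤ 1 →
      gainMass γ m r ≤ A * r ^ (3 / 4 : ℝ) := by
    intro n
    induction n with
    | zero =>
      intro r hr hr1
      simp only [pow_zero, div_one] at hr
      calc gainMass γ m r ≤ Q := hQ r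
        _ = Q / r₁ ^ (3 / 4 : ℝ) * r₁ ^ (3 / 4 : ℝ) := by
          have : r₁ ^ (3 / 4 : ℝ) ≠ 0 := by positivity
          field_simp
        _ ≤ A * r ^ (3 / 4 : ℝ) := by
          have : 0 ≤ 192 * Q * (1 / R + 3) := by positivity
          gcongr
          linarith
    | succ n ih =>
      intro r hr hr1
      by_cases hrn : r₁ / 2 ^ n ≤ r
      · exact ih r hrn hr1
      push Not at hrn
      have hrr₁ : r < r₁ := hrn.trans_le (div_le_self hr₁0.le (one_le_pow₀ (by norm_num)))
      have hr0 : 0 < r := lt_of_lt_of_le (by positivity) hr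
      have h2r : r₁ / 2 ^ n ≤ 2 * r := by
        rw [pow_succ, ← div_div, div_le_iff₀ (by norm_num)] at hr
        linarith
      have hrp : 0 < r ^ (3 / 4 : ℝ) := by positivity
      have hsplit := h.gainMass_le_ball_sq_add_far h0 h1 (K := 6) hr0 (by linarith)
      norm_num at hsplit
      -- Quadratic term: one factor q(12r) is at most ε, the other uses the induction hypothesis.
      have hnear : m.real {x : ℝ | |x| ≤ 6 * r} ^ 2 ≤ A * r ^ (3 / 4 : ℝ) / 4 := by
        have b1 := hball (6 * r) (by linarith) (by linarith)
        rw [show 2 * (6 * r) = 12 * r by ring] at b1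
        have g0 := gainMass_nonneg γ m (12 * r)
        have b2 : gainMass γ m (12 * r) ≤ ε :=
          (h.gainMass_mono h0 h1 (by linarith)).trans hqs
        have b3 := ih (12 * r) (by linarith) (by linarith)
        have b4 : (12 * r) ^ (3 / 4 : ℝ) ≤ 12 * r ^ (3 / 4 : ℝ) := by
          rw [Real.mul_rpow (by norm_num) hr0.le]
          gcongr
          exact Real.rpow_le_self_of_one_le (by norm_num) (by norm_num)
        calc m.real {x : ℝ | |x| ≤ 6 * r} ^ 2 ≤ (d * gainMass γ m (12 * r)) ^ 2 := by gcongr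
          _ = d ^ 2 * gainMass γ m (12 * r) * gainMass γ m (12 * r) := by ring
          _ ≤ d ^ 2 * ε * (A * (12 * r ^ (3 / 4 : ℝ))) := by
            gcongr
            exact b3.trans (by gcongr)
          _ = (48 * d ^ 2 * ε) * (A * r ^ (3 / 4 : ℝ) / 4) := by ring
          _ ≤ 1 * (A * r ^ (3 / 4 : ℝ) / 4) := by gcongr
          _ = _ := one_mul _
      have hY1 : MeasurableSet {y : ℝ | 4 * r < |y| ∧ |y| ≤ R} :=
        (measurableSet_lt_abs _).inter (measurableSet_abs_le _)
      have hmid := h.collision_far_le h0 h1 (r := r) (D := 384 * A * r ^ (3 / 4 : ℝ)) hr0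
        (by positivity) hY1 (fun y hy => by
          obtain ⟨hy4, hyR⟩ := hy
          have hy0 : 0 < |y| := by linarith
          refine ⟨hy4, ?_⟩
          have g := ih (2 * |y|) (by linarith) (by linarith)
          have g2 : (2 * |y|) ^ (3 / 4 : ℝ) ≤ 2 * |y| ^ (3 / 4 : ℝ) := by
            rw [Real.mul_rpow (by norm_num) hy0.le]
            gcongr
            exact Real.rpow_le_self_of_one_le (by norm_num) (by norm_num)
          -- An exponent below 1 is essential: |y|^(-1/4) ≤ r^(-1/4) absorbs all intermediate
          -- distances without a logarithm.
          have g3 : r * (|y| ^ (3 / 4 : ℝ) / |y|) ≤ r ^ (3 / 4 : ℝ) := by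
            have e1 : |y| ^ (3 / 4 : ℝ) / |y| = |y| ^ (-(1 / 4) : ℝ) := by
              rw [← Real.rpow_sub_one hy0.ne']
              norm_num
            have e2 : r ^ (3 / 4 : ℝ) = r * r ^ (-(1 / 4) : ℝ) := by
              nth_rw 2 [← Real.rpow_one r]
              rw [← Real.rpow_add hr0]
              norm_num
            rw [e1, e2]
            gcongr ?_ * ?_
            exact Real.rpow_le_rpow_of_nonpos hr0 (by linarith) (by norm_num)
          calc (1 + 3 * |y|) * (96 * r * gainMass γ m (2 * |y|) / |y|)
              ≤ 2 * (96 * r * (A * (2 * |y| ^ (3 / 4 : ℝ))) / |y|) := by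
                have g4 : gainMass γ m (2 * |y|) ≤ A * (2 * |y| ^ (3 / 4 : ℝ)) :=
                  g.trans (mul_le_mul_of_nonneg_left g2 hA0.le)
                have g5 := gainMass_nonneg γ m (2 * |y|)
                refine mul_le_mul (by linarith) ?_ (by positivity) (by norm_num)
                gcongr
            _ = 384 * A * (r * (|y| ^ (3 / 4 : ℝ) / |y|)) := by ring
            _ ≤ _ := by gcongr)
      have hmY : m.real {y : ℝ | 4 * r < |y| ∧ |y| ≤ R} ≤ d * ε := by
        calc _ ≤ m.real {x : ℝ | |x| ≤ R} := measureReal_mono fun x hx => hx.2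
          _ ≤ d * gainMass γ m (2 * R) := hball R hR0 (by linarith)
          _ ≤ d * ε := by
            rw [show 2 * R = s by rw [hR]; ring]
            gcongr
      have hmid' : 384 * A * r ^ (3 / 4 : ℝ) * m.real {y : ℝ | 4 * r < |y| ∧ |y| ≤ R} ≤
          A * r ^ (3 / 4 : ℝ) / 4 := by
        calc _ ≤ 384 * A * r ^ (3 / 4 : ℝ) * (d * ε) := by gcongr
          _ = (1536 * d * ε) * (A * r ^ (3 / 4 : ℝ) / 4) := by ring
          _ ≤ 1 * (A * r ^ (3 / 4 : ℝ) / 4) := by gcongr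
          _ = _ := one_mul _
      have hfar := h.far_gain_le h0 h1 hQ (r := r) (s := R) hr0 (by linarith)
      have hfar' : 96 * r * Q * (1 / R + 3) ≤ A * r ^ (3 / 4 : ℝ) / 2 := by
        have e1 : r ≤ r ^ (3 / 4 : ℝ) :=
          Real.self_le_rpow_of_le_one hr0.le hr1 (by norm_num)
        have e2 : 192 * Q * (1 / R + 3) ≤ A := by
          have : 0 ≤ Q / r₁ ^ (3 / 4 : ℝ) := by positivity
          linarith
        calc 96 * r * Q * (1 / R + 3) = (192 * Q * (1 / R + 3)) * r / 2 := by ring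
          _ ≤ _ := by gcongr
      have hsub : {p : ℝ × ℝ | |p.1 + p.2| ≤ 2 * r ∧ 4 * r < |p.2|} ⊆
          {p | |p.1 + p.2| ≤ 2 * r ∧ p.2 ∈ {y : ℝ | 4 * r < |y| ∧ |y| ≤ R}} ∪
          {p | |p.1 + p.2| ≤ 2 * r ∧ p.2 ∈ {y : ℝ | R < |y|}} := by
        rintro p ⟨hp, hp'⟩
        rcases le_or_gt |p.2| R with h3 | h3
        · exact Or.inl ⟨hp, hp', h3⟩
        · exact Or.inr ⟨hp, h3⟩
      have hm := (measureReal_mono (μ := collisionMeasure γ m) hsub).trans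
        (measureReal_union_le _ _)
      linarith
  intro r hr0 hr1
  obtain ⟨n, hn⟩ := exists_pow_lt_of_lt_one (show 0 < r / r₁ by positivity)
    (show (1 / 2 : ℝ) < 1 by norm_num)
  refine key n r ?_ hr1
  rw [lt_div_iff₀ hr₁0, one_div, inv_pow, ← div_eq_inv_mul] at hn
  exact hn.le

/-! ### Tail collisions by Chebyshev with the 5/2 moment -/

theorem tail_collision_le (h : SteadyMeasure γ m) (h0 : 0 ≤ γ) (h1 : γ < 1 / 2) {a : ℝ}
    (ha : 1 ≤ a) :
    (collisionMeasure γ m).real {p | a ≤ |p.1|} ≤ a ^ (γ - 5 / 2) *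
        ((∫ x : ℝ, √|x| ^ 5 ∂m) * (3 + ∫ x : ℝ, x ^ 2 ∂m)) ∧
    (collisionMeasure γ m).real {p | a ≤ |p.2|} ≤ a ^ (γ - 5 / 2) *
        ((∫ x : ℝ, √|x| ^ 5 ∂m) * (3 + ∫ x : ℝ, x ^ 2 ∂m)) := by
  have := h.prob
  have ha0 : 0 < a := by linarith
  have i5 := h.integrable_sqrt_pow (k := 5) le_rfl
  have i2 : Integrable (fun y : ℝ => 3 + y ^ 2) m := (integrable_const 3).add h.integrable_sq
  have e5 : ∀ t : ℝ, |t| ^ ((5 : ℝ) / 2) = √|t| ^ 5 := fun t => by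
    exact_mod_cast abs_rpow_half t 5
  have i2v : ∫ y : ℝ, (3 + y ^ 2) ∂m = 3 + ∫ x : ℝ, x ^ 2 ∂m := by
    rw [integral_add (integrable_const 3) h.integrable_sq]
    simp
  have pt : ∀ x y : ℝ, a ≤ |x| →
      |x - y| ^ γ ≤ a ^ (γ - 5 / 2) * (√|x| ^ 5 * (3 + y ^ 2)) := by
    intro x y hx
    have hx0 : 0 < |x| := by linarith
    have s1 := abs_sub_rpow_le_add h0 (by linarith) x y
    have s2 := abs_rpow_le_one_add (abs_nonneg y) h0 (by linarith)
    have s3 : 1 ≤ |x| ^ γ := Real.one_le_rpow (by linarith) h0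
    have s4 : |x| ^ γ ≤ a ^ (γ - 5 / 2) * √|x| ^ 5 := by
      have : |x| ^ γ = |x| ^ (γ - 5 / 2) * |x| ^ ((5 : ℝ) / 2) := by
        rw [← Real.rpow_add hx0]
        ring_nf
      rw [this, e5]
      gcongr ?_ * _
      exact Real.rpow_le_rpow_of_nonpos ha0 hx (by linarith)
    have s5 : 1 + (1 + |y|) ≤ 3 + y ^ 2 := by
      rw [← sq_abs]
      nlinarith [sq_nonneg (|y| - 1)]
    calc |x - y| ^ γ ≤ |x| ^ γ * (1 + (1 + |y|)) := by nlinarith [abs_nonneg y]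
      _ ≤ (a ^ (γ - 5 / 2) * √|x| ^ 5) * (3 + y ^ 2) := by gcongr
      _ = _ := by ring
  have val : ∀ A : Set (ℝ × ℝ), MeasurableSet A → (collisionMeasure γ m).real A =
      ∫ p, A.indicator (fun p => |p.1 - p.2| ^ γ) p ∂(m.prod m) := by
    intro A mA
    rw [← integral_indicator_const_one mA, integral_collisionMeasure]
    refine integral_congr_ae (Eventually.of_forall fun p => ?_)
    by_cases hp : p ∈ A <;> simp [hp]
  have ik := h.integrable_kernel h0 h1
  constructor
  · rw [val _ (measurableSet_fst_ge a), ← i2v, ← integral_prod_mul (fun x : ℝ => √|x| ^ 5)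
      (fun y : ℝ => 3 + y ^ 2), ← integral_const_mul]
    refine integral_mono (ik.indicator (measurableSet_fst_ge a))
      ((i5.mul_prod i2).const_mul _) fun p => ?_
    refine indicator_apply_le' (fun hp => pt p.1 p.2 hp) fun _ => by positivity
  · rw [val _ (measurableSet_snd_ge a), ← i2v, mul_comm (∫ x : ℝ, √|x| ^ 5 ∂m),
      ← integral_prod_mul (fun y : ℝ => 3 + y ^ 2) (fun x : ℝ => √|x| ^ 5), ← integral_const_mul]
    refine integral_mono (ik.indicator (measurableSet_snd_ge a))
      ((i2.mul_prod i5).const_mul _) fun p => ?_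
    refine indicator_apply_le' (fun hp => ?_) fun _ => by positivity
    rw [abs_sub_comm, mul_comm (3 + p.1 ^ 2)]
    exact pt p.2 p.1 hp

end SteadyMeasure

/-! ### From annuli to pointwise bounds and the envelope -/

theorem measureReal_withDensity_ofReal {G : ℝ → ℝ} (hGi : Integrable G) (hG : ∀ᵐ x : ℝ, 0 ≤ G x)
    {I : Set ℝ} (hI : MeasurableSet I) :
    (volume.withDensity fun x => ENNReal.ofReal (G x)).real I = ∫ x in I, G x := by
  rw [measureReal_def, withDensity_apply _ hI,
    integral_eq_lintegral_of_nonneg_ae (ae_restrict_of_ae hG) hGi.aestronglyMeasurable.restrict]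

/-- Lebesgue differentiation, one-sided and away from the origin: each annulus contains the interval
adjacent to x. The null set is independent of g and L, so both may depend on x. -/
theorem ae_le_of_annulus_le {G : ℝ → ℝ} (hGi : Integrable G) (hG : ∀ᵐ x : ℝ, 0 ≤ G x) :
    ∀ᵐ x : ℝ, ∀ (g : ℝ → ℝ) (L : ℝ), Tendsto g (𝓝[>] |x|) (𝓝 L) →
      (∀ᶠ b in 𝓝[>] |x|, (volume.withDensity fun x => ENNReal.ofReal (G x)).real
        {y | |x| < |y| ∧ |y| < b} ≤ (b - |x|) * g b) → G x ≤ L := by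
  have hfin : IsFiniteMeasure (volume.withDensity fun x => ENNReal.ofReal (G x)) :=
    isFiniteMeasure_withDensity_ofReal hGi.2
  filter_upwards [LocallyIntegrable.ae_hasDerivAt_integral hGi.locallyIntegrable, ae_ne_volume 0] with x hx hx0 g L
    hg hle
  have hs := (hx 0).tendsto_slope
  have hsub : ∀ a b : ℝ, (∫ t in (0 : ℝ)..b, G t) - ∫ t in (0 : ℝ)..a, G t = ∫ t in a..b, G t :=
    fun a b => intervalIntegral.integral_interval_sub_left hGi.intervalIntegrable
      hGi.intervalIntegrable
  rcases lt_or_gt_of_ne hx0 with hneg | hpos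
  · rw [abs_of_neg hneg] at hg hle
    have ht : Tendsto (fun b : ℝ => -b) (𝓝[>] (-x)) (𝓝[≠] x) := by
      rw [tendsto_nhdsWithin_iff]
      constructor
      · have : Tendsto (fun b : ℝ => -b) (𝓝 (-x)) (𝓝 (- -x)) := continuous_neg.tendsto _
        rw [neg_neg] at this
        exact this.mono_left nhdsWithin_le_nhds
      · filter_upwards [self_mem_nhdsWithin] with b hb
        have hb' : -x < b := hb
        simp only [mem_compl_iff, mem_singleton_iff]
        intro h
        linarith
    refine le_of_tendsto_of_tendsto (hs.comp ht) hg ?_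
    filter_upwards [hle, self_mem_nhdsWithin] with b hb hbx
    have hb' : -x < b := hbx
    have hbx' : 0 < b - -x := by linarith
    simp only [Function.comp_apply]
    rw [slope_def_field, div_le_iff_of_neg (by linarith)]
    have e : (∫ t in (0 : ℝ)..(-b), G t) - ∫ t in (0 : ℝ)..x, G t =
        -(volume.withDensity fun x => ENNReal.ofReal (G x)).real (Ioo (-b) x) := by
      rw [measureReal_withDensity_ofReal hGi hG measurableSet_Ioo, ← neg_sub, hsub,
        intervalIntegral.integral_of_le (by linarith), integral_Ioc_eq_integral_Ioo]
    rw [e]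
    have := (measureReal_mono (μ := volume.withDensity fun x => ENNReal.ofReal (G x))
      (show Ioo (-b) x ⊆ {y | -x < |y| ∧ |y| < b} from fun y hy => by
        have hy1 := hy.1
        have hy2 := hy.2
        simp only [mem_ofPred_eq]
        rw [abs_of_neg (by linarith)]
        constructor <;> linarith)).trans hb
    linarith
  · rw [abs_of_pos hpos] at hg hle
    refine le_of_tendsto_of_tendsto (hs.mono_left
      (nhdsWithin_mono x (show Ioi x ⊆ {x}ᶜ from fun y hy => ne_of_gt hy))) hg ?_
    filter_upwards [hle, self_mem_nhdsWithin] with b hb hbx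
    have hb' : x < b := hbx
    rw [slope_def_field, div_le_iff₀ (by linarith), hsub,
      intervalIntegral.integral_of_le hb'.le, integral_Ioc_eq_integral_Ioo,
      ← measureReal_withDensity_ofReal hGi hG measurableSet_Ioo]
    have := (measureReal_mono (μ := volume.withDensity fun x => ENNReal.ofReal (G x))
      (show Ioo x b ⊆ {y | x < |y| ∧ |y| < b} from fun y hy => by
        have hy1 := hy.1
        have hy2 := hy.2
        simp only [mem_ofPred_eq]
        rw [abs_of_pos (by linarith)]
        constructor <;> linarith)).trans hb
    linarith

/-- The square integrable function dominating all weighted profiles. -/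
noncomputable def envelope (δ C x : ℝ) : ℝ :=
  if |x| < 1 then C * |x| ^ (-(1 / 4) : ℝ) else C * |x| ^ (-(1 / 2) - δ)

theorem memLp_envelope {δ : ℝ} (hδ : 0 < δ) (C : ℝ) : MemLp (envelope δ C) 2 := by
  have hmeas : Measurable (envelope δ C) :=
    Measurable.ite (measurableSet_lt measurable_norm measurable_const)
      ((measurable_norm.pow_const _).const_mul C) ((measurable_norm.pow_const _).const_mul C)
  rw [memLp_two_iff_integrable_sq hmeas.aestronglyMeasurable]
  set f : ℝ → ℝ := fun y =>
    (if y < 1 then C * y ^ (-(1 / 4) : ℝ) else C * y ^ (-(1 / 2) - δ)) ^ 2 with hf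
  change Integrable (fun x : ℝ => f ‖x‖)
  rw [integrable_fun_norm_addHaar (μ := (volume : Measure ℝ))]
  simp only [Module.finrank_self, tsub_self, pow_zero, one_smul]
  rw [← Ioo_union_Ici_eq_Ioi (zero_lt_one' ℝ)]
  refine IntegrableOn.union ?_ ?_
  · have h1 : IntegrableOn (fun y : ℝ => C ^ 2 * y ^ (-(1 / 2) : ℝ)) (Ioo 0 1) :=
      ((intervalIntegral.integrableOn_Ioo_rpow_iff zero_lt_one).2 (by norm_num)).const_mul _
    refine h1.congr_fun (fun y hy => ?_) measurableSet_Ioo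
    simp only [hf, if_pos hy.2, mul_pow]
    rw [← Real.rpow_mul_natCast hy.1.le]
    norm_num
  · have h1 : IntegrableOn (fun y : ℝ => C ^ 2 * y ^ (-1 - 2 * δ)) (Ici 1) := by
      rw [integrableOn_Ici_iff_integrableOn_Ioi]
      exact (integrableOn_Ioi_rpow_of_lt (by linarith) zero_lt_one).const_mul _
    refine h1.congr_fun (fun y hy => ?_) measurableSet_Ici
    have hy1 : (1 : ℝ) ≤ y := hy
    simp only [hf, if_neg (not_lt.2 hy1), mul_pow]
    rw [← Real.rpow_mul_natCast (by linarith)]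
    congr 2
    push_cast
    ring

/-- For γ = 0 only the positivity of the prescribed energy enters, not its value. -/
theorem limitProfile_moment_two_pos : 0 < moment 2 limitProfile := by
  have hl : 0 < limitScale := Real.exp_pos _
  set l := limitScale with hldef
  have hcont : Continuous fun x : ℝ => limitProfile x * |x| ^ (2 : ℝ) := by
    unfold limitProfile maxwellProfile
    simp only [Real.rpow_two, sq_abs]
    refine ((continuous_const.mul (continuous_const.div ?_ fun x => ?_)).mul (by fun_prop))
    · fun_prop
    · positivity
  have hnn : ∀ x : ℝ, 0 ≤ limitProfile x * |x| ^ (2 : ℝ) := by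
    intro x
    unfold limitProfile maxwellProfile
    positivity
  have hint : Integrable fun x : ℝ => limitProfile x * |x| ^ (2 : ℝ) := by
    have h1 := (integrable_inv_one_add_sq.comp_mul_left' hl.ne').const_mul (2 / (Real.pi * l))
    refine h1.mono' hcont.aestronglyMeasurable (Eventually.of_forall fun x => ?_)
    rw [Real.norm_eq_abs, abs_of_nonneg (hnn x)]
    unfold limitProfile maxwellProfile
    simp only [Real.rpow_two, sq_abs]
    rw [← hldef]
    have hpi := Real.pi_pos
    have hq : 0 < 1 + (l * x) ^ 2 := by positivity
    have e : l * (2 / (Real.pi * (1 + (l * x) ^ 2) ^ 2)) * x ^ 2 =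
        2 / (Real.pi * l) * (((l * x) ^ 2 / (1 + (l * x) ^ 2)) * (1 + (l * x) ^ 2)⁻¹) := by
      field_simp
    rw [e]
    gcongr
    refine mul_le_of_le_one_left (by positivity) ?_
    rw [div_le_one hq]
    linarith
  refine integral_pos_of_integrable_nonneg_nonzero (x := 1) hcont hint hnn ?_
  unfold limitProfile maxwellProfile
  positivity

/-- Uniform pointwise bounds on the self-similar profiles. -/
theorem exists_pointwise_bounds {E : ℝ} (hE : 0 < E) :
    ∃ A W : ℝ, 0 < A ∧ 0 < W ∧ ∀ γ : ℝ, 0 ≤ γ → γ < 1 / 2 → ∀ G ∈ profiles γ,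
      (γ = 0 → moment 2 G = E) → ∀ᵐ x : ℝ,
        (|x| < 1 → G x ≤ A * |x| ^ (-(1 / 4) : ℝ)) ∧ (1 ≤ |x| → G x ≤ W * |x| ^ (γ - 7 / 2)) := by
  obtain ⟨c, C, hc, hC, hmom⟩ := SteadyMeasure.moment_bounds hE
  -- With l and ρ so chosen, the inner and the remote part of the energy are each at most c/3, so at
  -- least c/3 comes from the mass κ beyond ρ.
  set l : ℝ := 3 * C / c with hl
  have hl0 : 0 < l := by positivity
  set ρ : ℝ := min 1 (√(c / 3)) with hρ
  have hρ0 : 0 < ρ := by positivity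
  have hρc : ρ ^ 2 ≤ c / 3 := by
    calc ρ ^ 2 ≤ √(c / 3) ^ 2 := by
          gcongr
          exact min_le_right _ _
      _ = c / 3 := Real.sq_sqrt (by positivity)
  set κ : ℝ := c / 3 / l ^ 4 with hκ
  set Q : ℝ := 2 + 2 * C with hQ
  obtain ⟨A, hA0, hA⟩ := SteadyMeasure.exists_gainMass_le_rpow (ρ := ρ) (κ := κ) (Q := Q) hρ0
    (min_le_left _ _) (by positivity) (by positivity)
  refine ⟨4 * A, 4 * (C * (3 + C)), by positivity, by positivity,
    fun γ h0 h1 G hG hGE => ?_⟩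
  have hGp : IsProfile γ G := hG
  have hm := hGp.steadyMeasure h0 (by linarith)
  have hGi : Integrable G := by
    have := hGp.memWeighted 0 (by norm_num)
    unfold MemWeighted weight at this
    simpa [memLp_one_iff_integrable] using this
  set m := volume.withDensity fun x => ENNReal.ofReal (G x) with hmdef
  have hprob := hm.prob
  have hE2 : γ = 0 → ∫ x : ℝ, x ^ 2 ∂m = E := by
    intro hγ
    rw [← hGE hγ, moment, hmdef, integral_withDensity_eq_integral_toReal_smul₀
      hGi.aestronglyMeasurable.aemeasurable.ennreal_ofReal
      (Eventually.of_forall fun x => ENNReal.ofReal_lt_top)]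
    refine integral_congr_ae ?_
    filter_upwards [hGp.nonneg] with x hx
    simp [ENNReal.toReal_ofReal hx]
  obtain ⟨b1, b2, b3⟩ := hmom γ h0 h1 m hm hE2
  have hQm : ∀ t, gainMass γ m t ≤ Q := fun t => (hm.gainMass_le h0 h1 t).trans (by linarith)
  have hκm : κ ≤ m.real {x : ℝ | ρ ≤ |x|} := by
    have h3 := hm.measure_away_ge (ρ := ρ) hl0 b1 b3
    have h4 : C / l = c / 3 := by
      rw [hl]
      field_simp
    rw [hκ, div_le_iff₀ (by positivity)]
    linarith
  have hgain := hA γ h0 h1 m hm hκm hQm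
  filter_upwards [ae_le_of_annulus_le hGi hGp.nonneg, ae_ne_volume 0] with x hx hx0
  have hxp : 0 < |x| := abs_pos.2 hx0
  constructor
  · intro hx1
    refine hx (fun b => 4 * A * b ^ (3 / 4 : ℝ) / |x|) _ ?_ ?_
    · have e : 4 * A * |x| ^ (-(1 / 4) : ℝ) = 4 * A * |x| ^ (3 / 4 : ℝ) / |x| := by
        rw [mul_div_assoc, ← Real.rpow_sub_one hxp.ne']
        norm_num
      rw [e]
      refine Tendsto.mono_left ?_ nhdsWithin_le_nhds
      exact ((Real.continuousAt_rpow_const _ _ (Or.inr (by norm_num))).tendsto.const_mul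
        _).div_const _
    · filter_upwards [Ioo_mem_nhdsGT hx1] with b hb
      have hab := hm.annulus_le_gainMass h0 h1 hxp.le hb.1
      have hg := hgain b (hxp.trans hb.1) hb.2.le
      have hba : 0 < b - |x| := by linarith [hb.1]
      rw [mul_div_assoc', le_div_iff₀ hxp]
      calc _ = |x| * m.real {y | |x| < |y| ∧ |y| < b} := mul_comm _ _
        _ ≤ 4 * (b - |x|) * gainMass γ m b := hab
        _ ≤ 4 * (b - |x|) * (A * b ^ (3 / 4 : ℝ)) := by gcongr
        _ = _ := by ring
  · intro hx1
    refine hx (fun _ => 4 * (C * (3 + C)) * |x| ^ (γ - 7 / 2)) _ tendsto_const_nhds ?_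
    filter_upwards [self_mem_nhdsWithin] with b hb
    have hb' : |x| < b := hb
    have hba : 0 < b - |x| := by linarith
    have hab := hm.annulus_le_tail h0 h1 hxp.le hb'
    obtain ⟨t1, t2⟩ := hm.tail_collision_le h0 h1 hx1
    have hS : (∫ x : ℝ, √|x| ^ 5 ∂m) * (3 + ∫ x : ℝ, x ^ 2 ∂m) ≤ C * (3 + C) := by
      gcongr
    have hr : 0 ≤ |x| ^ (γ - 5 / 2) := by positivity
    have hS' := mul_le_mul_of_nonneg_left hS hr
    have e : |x| ^ (γ - 7 / 2) * |x| = |x| ^ (γ - 5 / 2) := by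
      nth_rw 2 [← Real.rpow_one |x|]
      rw [← Real.rpow_add hxp]
      ring_nf
    refine le_of_mul_le_mul_left ?_ hxp
    calc |x| * m.real {y | |x| < |y| ∧ |y| < b} ≤ _ := hab
      _ ≤ 2 * (b - |x|) * (|x| ^ (γ - 5 / 2) * (C * (3 + C)) +
            |x| ^ (γ - 5 / 2) * (C * (3 + C))) := by
          gcongr
          · exact t1.trans hS'
          · exact t2.trans hS'
      _ = |x| * ((b - |x|) * (4 * (C * (3 + C)) * |x| ^ (γ - 7 / 2))) := by
          rw [← e]
          ring

theorem weight_le_near {k x : ℝ} (hk : k ≤ 3) (hx : |x| < 1) : weight k x ≤ 8 := by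
  have h1 : 1 ≤ 1 + |x| := by linarith [abs_nonneg x]
  calc weight k x ≤ (1 + |x|) ^ (3 : ℝ) := Real.rpow_le_rpow_of_exponent_le h1 hk
    _ ≤ 2 ^ (3 : ℝ) := Real.rpow_le_rpow (by linarith) (by linarith) (by norm_num)
    _ = 8 := by norm_num

theorem weight_le_far {k s x : ℝ} (hks : k ≤ s) (hs0 : 0 ≤ s) (hs3 : s ≤ 3) (hx : 1 ≤ |x|) :
    weight k x ≤ 8 * |x| ^ s := by
  have hx0 : 0 ≤ |x| := abs_nonneg x
  calc weight k x ≤ (1 + |x|) ^ s := Real.rpow_le_rpow_of_exponent_le (by linarith) hks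
    _ ≤ (2 * |x|) ^ s := Real.rpow_le_rpow (by linarith) (by linarith) hs0
    _ = 2 ^ s * |x| ^ s := Real.mul_rpow (by norm_num) hx0
    _ ≤ 2 ^ (3 : ℝ) * |x| ^ s := by
      gcongr
      norm_num
    _ = 8 * |x| ^ s := by norm_num

end StickyParticles

theorem corollary3p5 (δ : ℝ) (hδ : δ ∈ Set.Ioo (0 : ℝ) (1 / 2)) :
    ∃ γs ∈ Set.Ioo (0 : ℝ) 1, ∃ C : ℝ, 0 < C ∧
      ∀ γ ∈ Set.Ico (0 : ℝ) γs, ∀ k : ℝ, k + γ ∈ Set.Ioo (0 : ℝ) (3 - δ) →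
        ∀ G ∈ StickyParticles.profiles γ,
          (γ = 0 →
            StickyParticles.moment 2 G =
              StickyParticles.moment 2 StickyParticles.limitProfile) →
          StickyParticles.weightedNorm 2 (StickyParticles.weight k) G ≤ ENNReal.ofReal C := by
  obtain ⟨A, W, hA, hW, H⟩ :=
    StickyParticles.exists_pointwise_bounds StickyParticles.limitProfile_moment_two_pos
  have hB := StickyParticles.memLp_envelope hδ.1 (8 * (A + W))
  -- The threshold 1/2 is what the 5/2 moment identity allows: 5/2 + γ < 3. The added 1 makes C
  -- positive; 8 = 2³ comes from the weight.
  refine ⟨1 / 2, by norm_num, (eLpNorm (StickyParticles.envelope δ (8 * (A + W))) 2).toReal + 1,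
    by positivity, fun γ hγ k hk G hG hE => ?_⟩
  refine le_trans ?_ (ENNReal.ofReal_le_ofReal (le_add_of_nonneg_right zero_le_one))
  rw [ENNReal.ofReal_toReal hB.eLpNorm_ne_top]
  refine eLpNorm_mono_ae_real ?_
  have hGp : StickyParticles.IsProfile γ G := hG
  filter_upwards [H γ hγ.1 hγ.2 G hG hE, hGp.nonneg, StickyParticles.ae_ne_volume 0] with x hx hG0
    hx0
  have hxp : 0 < |x| := abs_pos.2 hx0
  have hw0 : 0 ≤ StickyParticles.weight k x := Real.rpow_nonneg (by positivity) k
  rw [Real.norm_eq_abs, abs_of_nonneg (mul_nonneg hG0 hw0)]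
  have hk3 := hk.2
  have hγ0 := hγ.1
  have hγ1 := hγ.2
  have hδ0 := hδ.1
  have hδ1 := hδ.2
  unfold StickyParticles.envelope
  by_cases hx1 : |x| < 1
  · rw [if_pos hx1]
    calc G x * StickyParticles.weight k x ≤ (A * |x| ^ (-(1 / 4) : ℝ)) * 8 :=
          mul_le_mul (hx.1 hx1) (StickyParticles.weight_le_near (by linarith) hx1) hw0
            (by positivity)
      _ = 8 * A * |x| ^ (-(1 / 4) : ℝ) := by ring
      _ ≤ _ := by
        gcongr
        linarith
  · rw [if_neg hx1]
    have hx1' := le_of_not_gt hx1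
    -- The growth γ of the tail exponent is offset by k ≤ 3 - δ - γ, leaving |x|^(-1/2-δ), square
    -- integrable at infinity.
    calc G x * StickyParticles.weight k x ≤ (W * |x| ^ (γ - 7 / 2)) * (8 * |x| ^ (3 - δ - γ)) :=
          mul_le_mul (hx.2 hx1') (StickyParticles.weight_le_far (by linarith) (by linarith)
            (by linarith) hx1') hw0 (by positivity)
      _ = 8 * W * (|x| ^ (γ - 7 / 2) * |x| ^ (3 - δ - γ)) := by ring
      _ = 8 * W * |x| ^ (-(1 / 2) - δ) := by
        rw [← Real.rpow_add hxp]
        ring_nf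
      _ ≤ _ := by
        gcongr
        linarith
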